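/- **Conventions.** A shadow on a bicategory $\mathcal C$ with values in a category $\mathcal C_{Sh}$ consists of functors $\langle\langle-\rangle\rangle\colon \mathcal C(A,A)\to\mathcal C_{Sh}$ for every 0-cell $A$ and natural isomorphisms (rotators) $\theta\colon\langle\langle M\odot N\rangle\rangle\cong\langle\langle N\odot M\rangle\rangle$, for $M\in\mathcal C(A,B)$ and $N\in\mathcal C(B,A)$, compatible with the associators (the hexagon) and with the unitors ($\ell\circ\theta_{M,I}=r$ and $r\circ\theta_{I,M}=\ell$, after applying $\langle\langle-\rangle\rangle$). A strong shadow functor $(F,H)\colon(\mathcal C,\mathcal C_{Sh})\to(\mathcal D,\mathcal D_{Sh})$ consists of a pseudofunctor $F\colon\mathcal C\to\mathcal D$ with composition isomorphisms $m$, a functor $H\colon\mathcal C_{Sh}\to\mathcal D_{Sh}$, and isomorphisms $s\colon\langle\langle F(M)\rangle\rangle\cong H\langle\langle M\rangle\rangle$, natural in the endomorphism 1-cell $M$ of $\mathcal C$, such that $H(\theta)\circ s\circ\langle\langle m\rangle\rangle=s\circ\langle\langle m\rangle\rangle\circ\theta$ as maps $\langle\langle F(M)\odot F(N)\rangle\rangle\to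 H\langle\langle N\odot M\rangle\rangle$. Let $G$ be the graph of 0-cells and 1-cells of $\mathcal C$, and let $\mathcal L_{Sh}(G)$ be the target shadow category of the free strong shadow functor on $G$. Its objects are the expressions $H\langle\langle W\rangle\rangle$, with $W$ an endomorphism 1-cell of the free bicategory on $G$, and $\langle\langle V\rangle\rangle$, with $V$ a cyclically composable parenthesized word in formal units and letters $F(W)$, where $W$ is a 1-cell of the free bicategory on $G$. Its morphisms, the *formal morphisms*, are generated by associators and unitors (inside and outside $F$ and inside $H$), rotators (on $\langle\langle V\rangle\rangle$ and inside $H$), the unit and composition maps of $F$, the maps $s$, and the inverses of all of these, modulo the axioms of bicategories, shadows, pseudofunctors and strong shadow functors. There is a canonical strict evaluation functor $\mathcal L_{Sh}(G)\to\mathcal D_{Sh}$. Every object has an underlying list $X_1,\dots,X_n$ of edges of $G$, and every formal morphism induces a rotation (cyclic permutation) of the positions $\{1,\dots,n\}$: a rotator exchanges the two blocks of edges, and all other generators act trivially. A diagram in $\mathcal D_{Sh}$ is *formal* if it lifts along the evaluation functor. It is *expected to commute* if it has a lift in which any two parallel composites induce the same rotation. A list is *aperiodic* if no nontrivial rotation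 of its terms returns the same list. **Theorem (coherence for strong shadow functors).** Let $(F,H)\colon(\mathcal C,\mathcal C_{Sh})\to(\mathcal D,\mathcal D_{Sh})$ be a strong shadow functor between bicategories with shadow. Then: 1. every formal diagram in $\mathcal D_{Sh}$ that is expected to commute commutes; 2. equivalently, any two parallel formal morphisms that induce the same rotation of the $X_i$ have equal images in $\mathcal D_{Sh}$; 3. every formal diagram that has a lift in which the list of edges $X_1,\dots,X_n$ of each object is aperiodic commutes. -/

import Mathlib

open CategoryTheory Bicategory

universe w₁ w₂ w₃ v₁ v₂ v₃ v₄ u₁ u₂ u₃ u₄ v u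

namespace ShadowCoherence

/-! ### Bicategories with shadow and strong shadow functors -/

/-- A shadow on a bicategory `B` with values in a category `T`: functors `sh a : B(a, a) ⥤ T`
together with natural isomorphisms (rotators) `θ : ⟨⟨f ⊙ g⟩⟩ ≅ ⟨⟨g ⊙ f⟩⟩` compatible with the
associators and the unitors. -/
structure Shadow (B : Type u₁) [Bicategory.{w₁, v₁} B] (T : Type u₂) [Category.{v₂} T] where
  /-- The shadow `⟨⟨-⟩⟩` on endomorphism 1-cells of `a`. -/
  sh (a : B) : (a ⟶ a) ⥤ T
  /-- The rotator. -/
  θ {a b : B} (f : a ⟶ b) (g : b ⟶ a) : (sh a).obj (f ≫ g) ≅ (sh b).obj (g ≫ f)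
  θ_naturality_left {a b : B} {f f' : a ⟶ b} (η : f ⟶ f') (g : b ⟶ a) :
    (sh a).map (η ▷ g) ≫ (θ f' g).hom = (θ f g).hom ≫ (sh b).map (g ◁ η)
  θ_naturality_right {a b : B} (f : a ⟶ b) {g g' : b ⟶ a} (η : g ⟶ g') :
    (sh a).map (f ◁ η) ≫ (θ f g').hom = (θ f g).hom ≫ (sh b).map (η ▷ f)
  θ_assoc {a b c : B} (f : a ⟶ b) (g : b ⟶ c) (h : c ⟶ a) :
    (θ (f ≫ g) h).hom ≫ (sh c).map (α_ h f g).inv ≫ (θ (h ≫ f) g).hom =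
      (sh a).map (α_ f g h).hom ≫ (θ f (g ≫ h)).hom ≫ (sh b).map (α_ g h f).hom
  θ_unit_right {a : B} (f : a ⟶ a) :
    (θ f (𝟙 a)).hom ≫ (sh a).map (λ_ f).hom = (sh a).map (ρ_ f).hom
  θ_unit_left {a : B} (f : a ⟶ a) :
    (θ (𝟙 a) f).hom ≫ (sh a).map (ρ_ f).hom = (sh a).map (λ_ f).hom

/-- A strong shadow functor between bicategories with shadow: a pseudofunctor `F` (a lax functor
whose unit maps `i = (mapId _).inv` and composition maps `m = (mapComp _ _).inv` are isomorphisms),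
a functor `H` between the shadow categories, and natural isomorphisms
`s : ⟨⟨F M⟩⟩ ≅ H ⟨⟨M⟩⟩` compatible with the rotators. -/
structure StrongShadowFunctor {C : Type u₁} [Bicategory.{w₁, v₁} C] {T : Type u₂} [Category.{v₂} T]
    {D : Type u₃} [Bicategory.{w₃, v₃} D] {T' : Type u₄} [Category.{v₄} T']
    (S : Shadow C T) (S' : Shadow D T') where
  /-- The pseudofunctor. -/
  F : C ⥤ᵖ D
  /-- The functor on shadow categories. -/
  H : T ⥤ T'
  /-- The shadow commutator. -/
  s {a : C} (f : a ⟶ a) : (S'.sh (F.obj a)).obj (F.map f) ≅ H.obj ((S.sh a).obj f)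
  s_naturality {a : C} {f g : a ⟶ a} (η : f ⟶ g) :
    (S'.sh (F.obj a)).map (F.map₂ η) ≫ (s g).hom = (s f).hom ≫ H.map ((S.sh a).map η)
  s_θ {a b : C} (f : a ⟶ b) (g : b ⟶ a) :
    (S'.θ (F.map f) (F.map g)).hom ≫ (S'.sh (F.obj b)).map (F.mapComp g f).inv ≫ (s (g ≫ f)).hom =
      (S'.sh (F.obj a)).map (F.mapComp f g).inv ≫ (s (f ≫ g)).hom ≫ H.map (S.θ f g).hom

theorem mapComp_associator_inv {B : Type u₁} [Bicategory.{w₁, v₁} B] {C : Type u₃}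
    [Bicategory.{w₃, v₃} C] (E : B ⥤ᵖ C) {a b c d : B} (f : a ⟶ b) (g : b ⟶ c) (h : c ⟶ d) :
    (E.mapComp f (g ≫ h)).inv ≫ E.map₂ (α_ f g h).inv ≫ (E.mapComp (f ≫ g) h).hom =
      E.map f ◁ (E.mapComp g h).hom ≫ (α_ (E.map f) (E.map g) (E.map h)).inv ≫
        (E.mapComp f g).inv ▷ E.map h := by
  have h₁ := E.mapComp_assoc_right_hom f g h
  rw [Iso.inv_comp_eq, ← cancel_mono ((E.mapComp f g).hom ▷ E.map h),
    ← cancel_mono (α_ (E.map f) (E.map g) (E.map h)).hom]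
  simp only [Category.assoc] at h₁ ⊢
  rw [← h₁]
  simp

/-- Restriction of a shadow along a pseudofunctor. -/
def Shadow.pullback {B : Type u₁} [Bicategory.{w₁, v₁} B] {C : Type u₃} [Bicategory.{w₃, v₃} C]
    {T : Type u₂} [Category.{v₂} T] (S : Shadow C T) (E : B ⥤ᵖ C) : Shadow B T where
  sh a :=
    { obj := fun f => (S.sh (E.obj a)).obj (E.map f)
      map := fun η => (S.sh (E.obj a)).map (E.map₂ η)
      map_id := fun f => by rw [E.map₂_id, CategoryTheory.Functor.map_id]
      map_comp := fun η θ => by rw [E.map₂_comp, Functor.map_comp] }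
  θ f g := (S.sh _).mapIso (E.mapComp f g) ≪≫ S.θ (E.map f) (E.map g) ≪≫
    (S.sh _).mapIso (E.mapComp g f).symm
  θ_naturality_left {a b f f'} η g := by
    have h := S.θ_naturality_left (E.map₂ η) (E.map g)
    simp only [Iso.trans_hom, Functor.mapIso_hom, Iso.symm_hom, Category.assoc,
      E.map₂_whisker_left, E.map₂_whisker_right, Functor.map_comp]
    rw [← Functor.map_comp_assoc _ (E.mapComp f' g).inv, Iso.inv_hom_id, CategoryTheory.Functor.map_id,
      Category.id_comp, ← Functor.map_comp_assoc _ (E.mapComp g f).inv, Iso.inv_hom_id,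
      CategoryTheory.Functor.map_id, Category.id_comp, reassoc_of% h]
  θ_naturality_right {a b} f {g g'} η := by
    have h := S.θ_naturality_right (E.map f) (E.map₂ η)
    simp only [Iso.trans_hom, Functor.mapIso_hom, Iso.symm_hom, Category.assoc,
      E.map₂_whisker_left, E.map₂_whisker_right, Functor.map_comp]
    rw [← Functor.map_comp_assoc _ (E.mapComp f g').inv, Iso.inv_hom_id, CategoryTheory.Functor.map_id,
      Category.id_comp, ← Functor.map_comp_assoc _ (E.mapComp g f).inv, Iso.inv_hom_id,
      CategoryTheory.Functor.map_id, Category.id_comp, reassoc_of% h]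
  θ_assoc {a b c} f g h := by
    have k₁ := congrArg (S.sh _).map (mapComp_associator_inv E h f g)
    have n₁ := S.θ_naturality_left (E.mapComp f g).hom (E.map h)
    have n₂ := S.θ_naturality_left (E.mapComp h f).inv (E.map g)
    have n₃ := S.θ_naturality_right (E.map f) (E.mapComp g h).inv
    have a₁ := S.θ_assoc (E.map f) (E.map g) (E.map h)
    have e {x : C} {X Y : x ⟶ x} (t : X ≅ Y) {Z : T} (q : (S.sh _).obj Y ⟶ Z) :
        (S.sh _).map t.inv ≫ (S.sh _).map t.hom ≫ q = q := by
      rw [← Functor.map_comp_assoc, Iso.inv_hom_id, CategoryTheory.Functor.map_id, Category.id_comp]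
    have e' {Z : T} (q : (S.sh _).obj _ ⟶ Z) :
        (S.sh _).map ((E.mapComp g h).inv ▷ E.map f) ≫
          (S.sh _).map ((E.mapComp g h).hom ▷ E.map f) ≫ q = q := by
      rw [← Functor.map_comp_assoc, inv_hom_whiskerRight, CategoryTheory.Functor.map_id,
        Category.id_comp]
    simp only [Functor.map_comp] at k₁
    simp only [Iso.trans_hom, Functor.mapIso_hom, Iso.symm_hom, Category.assoc,
      E.map₂_associator, Functor.map_comp, e]
    rw [reassoc_of% k₁, ← reassoc_of% n₁, reassoc_of% n₂, reassoc_of% a₁, reassoc_of% n₃, e']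
  θ_unit_right {a} f := by
    have h := S.θ_unit_right (E.map f)
    have n := S.θ_naturality_right (E.map f) (E.mapId a).hom
    simp only [Iso.trans_hom, Functor.mapIso_hom, Iso.symm_hom, Category.assoc,
      E.map₂_left_unitor, E.map₂_right_unitor, Functor.map_comp]
    rw [← Functor.map_comp_assoc _ (E.mapComp (𝟙 a) f).inv, Iso.inv_hom_id,
      CategoryTheory.Functor.map_id, Category.id_comp, ← h, reassoc_of% n]
  θ_unit_left {a} f := by
    have h := S.θ_unit_left (E.map f)
    have n := S.θ_naturality_left (E.mapId a).hom (E.map f)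
    simp only [Iso.trans_hom, Functor.mapIso_hom, Iso.symm_hom, Category.assoc,
      E.map₂_left_unitor, E.map₂_right_unitor, Functor.map_comp]
    rw [← Functor.map_comp_assoc _ (E.mapComp f (𝟙 a)).inv, Iso.inv_hom_id,
      CategoryTheory.Functor.map_id, Category.id_comp, ← h, reassoc_of% n]

/-! ### The free bicategory receiving a pseudofunctor from a given bicategory -/

/-- The 0-cells of the free bicategory receiving a pseudofunctor from `B` are those of `B`. -/
def PseudoTarget (B : Type u₁) : Type u₁ := B

namespace PseudoTarget

section

variable {B : Type u₁} [Bicategory.{w₁, v₁} B]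

/-- The 1-cells: parenthesized composable words in formal units and letters `F(w)`, for `w` a
1-cell of `B`. -/
inductive Hom : B → B → Type max u₁ v₁
  | app {a b : B} (w : a ⟶ b) : Hom a b
  | id (a : B) : Hom a a
  | comp {a b c : B} (f : Hom a b) (g : Hom b c) : Hom a c

instance categoryStruct : CategoryStruct.{max u₁ v₁} (PseudoTarget B) where
  Hom := fun a b : B => Hom a b
  id := fun a : B => Hom.id a
  comp := @fun _ _ _ => Hom.comp

/-- Formal composites of the generating 2-cells. -/
inductive Hom₂ : ∀ {a b : B}, Hom a b → Hom a b → Type max u₁ v₁ w₁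
  | id {a b : B} (f : Hom a b) : Hom₂ f f
  | vcomp {a b : B} {f g h : Hom a b} (η : Hom₂ f g) (θ : Hom₂ g h) : Hom₂ f h
  | whisker_left {a b c : B} (f : Hom a b) {g h : Hom b c} (η : Hom₂ g h) :
      Hom₂ (f.comp g) (f.comp h)
  | whisker_right {a b c : B} {f g : Hom a b} (h : Hom b c) (η : Hom₂ f g) :
      Hom₂ (f.comp h) (g.comp h)
  | associator {a b c d : B} (f : Hom a b) (g : Hom b c) (h : Hom c d) :
      Hom₂ ((f.comp g).comp h) (f.comp (g.comp h))
  | associator_inv {a b c d : B} (f : Hom a b) (g : Hom b c) (h : Hom c d) :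
      Hom₂ (f.comp (g.comp h)) ((f.comp g).comp h)
  | right_unitor {a b : B} (f : Hom a b) : Hom₂ (f.comp (Hom.id b)) f
  | right_unitor_inv {a b : B} (f : Hom a b) : Hom₂ f (f.comp (Hom.id b))
  | left_unitor {a b : B} (f : Hom a b) : Hom₂ ((Hom.id a).comp f) f
  | left_unitor_inv {a b : B} (f : Hom a b) : Hom₂ f ((Hom.id a).comp f)
  | app {a b : B} {w w' : a ⟶ b} (η : w ⟶ w') : Hom₂ (Hom.app w) (Hom.app w')
  | unit (a : B) : Hom₂ (Hom.id a) (Hom.app (𝟙 a))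
  | unit_inv (a : B) : Hom₂ (Hom.app (𝟙 a)) (Hom.id a)
  | mul {a b c : B} (w : a ⟶ b) (w' : b ⟶ c) :
      Hom₂ ((Hom.app w).comp (Hom.app w')) (Hom.app (w ≫ w'))
  | mul_inv {a b c : B} (w : a ⟶ b) (w' : b ⟶ c) :
      Hom₂ (Hom.app (w ≫ w')) ((Hom.app w).comp (Hom.app w'))

/-- Relations between formal composites of 2-cells: the axioms of a bicategory, and the axioms
making `F(-)` a pseudofunctor with unit `i` (`unit`) and composition `m` (`mul`). -/
inductive Rel : ∀ {a b : B} {f g : Hom a b}, Hom₂ f g → Hom₂ f g → Prop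
  | vcomp_right {a b : B} {f g h : Hom a b} (η : Hom₂ f g) (θ₁ θ₂ : Hom₂ g h) :
      Rel θ₁ θ₂ → Rel (η.vcomp θ₁) (η.vcomp θ₂)
  | vcomp_left {a b : B} {f g h : Hom a b} (η₁ η₂ : Hom₂ f g) (θ : Hom₂ g h) :
      Rel η₁ η₂ → Rel (η₁.vcomp θ) (η₂.vcomp θ)
  | id_comp {a b : B} {f g : Hom a b} (η : Hom₂ f g) : Rel ((Hom₂.id f).vcomp η) η
  | comp_id {a b : B} {f g : Hom a b} (η : Hom₂ f g) : Rel (η.vcomp (Hom₂.id g)) η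
  | assoc {a b : B} {f g h i : Hom a b} (η : Hom₂ f g) (θ : Hom₂ g h) (ι : Hom₂ h i) :
      Rel ((η.vcomp θ).vcomp ι) (η.vcomp (θ.vcomp ι))
  | whisker_left {a b c : B} (f : Hom a b) (g h : Hom b c) (η η' : Hom₂ g h) :
      Rel η η' → Rel (η.whisker_left f) (η'.whisker_left f)
  | whisker_left_id {a b c : B} (f : Hom a b) (g : Hom b c) :
      Rel ((Hom₂.id g).whisker_left f) (Hom₂.id (f.comp g))
  | whisker_left_comp {a b c : B} (f : Hom a b) {g h i : Hom b c} (η : Hom₂ g h) (θ : Hom₂ h i) :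
      Rel ((η.vcomp θ).whisker_left f) ((η.whisker_left f).vcomp (θ.whisker_left f))
  | id_whisker_left {a b : B} {f g : Hom a b} (η : Hom₂ f g) :
      Rel (η.whisker_left (Hom.id a))
        ((Hom₂.left_unitor f).vcomp (η.vcomp (Hom₂.left_unitor_inv g)))
  | comp_whisker_left {a b c d : B} (f : Hom a b) (g : Hom b c) {h h' : Hom c d} (η : Hom₂ h h') :
      Rel (η.whisker_left (f.comp g))
        ((Hom₂.associator f g h).vcomp
          (((η.whisker_left g).whisker_left f).vcomp (Hom₂.associator_inv f g h')))
  | whisker_right {a b c : B} (f g : Hom a b) (h : Hom b c) (η η' : Hom₂ f g) :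
      Rel η η' → Rel (η.whisker_right h) (η'.whisker_right h)
  | id_whisker_right {a b c : B} (f : Hom a b) (g : Hom b c) :
      Rel ((Hom₂.id f).whisker_right g) (Hom₂.id (f.comp g))
  | comp_whisker_right {a b c : B} {f g h : Hom a b} (i : Hom b c) (η : Hom₂ f g) (θ : Hom₂ g h) :
      Rel ((η.vcomp θ).whisker_right i) ((η.whisker_right i).vcomp (θ.whisker_right i))
  | whisker_right_id {a b : B} {f g : Hom a b} (η : Hom₂ f g) :
      Rel (η.whisker_right (Hom.id b))
        ((Hom₂.right_unitor f).vcomp (η.vcomp (Hom₂.right_unitor_inv g)))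
  | whisker_right_comp {a b c d : B} {f f' : Hom a b} (g : Hom b c) (h : Hom c d)
      (η : Hom₂ f f') :
      Rel (η.whisker_right (g.comp h))
        ((Hom₂.associator_inv f g h).vcomp
          (((η.whisker_right g).whisker_right h).vcomp (Hom₂.associator f' g h)))
  | whisker_assoc {a b c d : B} (f : Hom a b) {g g' : Hom b c} (η : Hom₂ g g') (h : Hom c d) :
      Rel ((η.whisker_left f).whisker_right h)
        ((Hom₂.associator f g h).vcomp
          (((η.whisker_right h).whisker_left f).vcomp (Hom₂.associator_inv f g' h)))
  | whisker_exchange {a b c : B} {f g : Hom a b} {h i : Hom b c} (η : Hom₂ f g) (θ : Hom₂ h i) :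
      Rel ((θ.whisker_left f).vcomp (η.whisker_right i))
        ((η.whisker_right h).vcomp (θ.whisker_left g))
  | associator_hom_inv {a b c d : B} (f : Hom a b) (g : Hom b c) (h : Hom c d) :
      Rel ((Hom₂.associator f g h).vcomp (Hom₂.associator_inv f g h))
        (Hom₂.id ((f.comp g).comp h))
  | associator_inv_hom {a b c d : B} (f : Hom a b) (g : Hom b c) (h : Hom c d) :
      Rel ((Hom₂.associator_inv f g h).vcomp (Hom₂.associator f g h))
        (Hom₂.id (f.comp (g.comp h)))
  | left_unitor_hom_inv {a b : B} (f : Hom a b) :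
      Rel ((Hom₂.left_unitor f).vcomp (Hom₂.left_unitor_inv f)) (Hom₂.id ((Hom.id a).comp f))
  | left_unitor_inv_hom {a b : B} (f : Hom a b) :
      Rel ((Hom₂.left_unitor_inv f).vcomp (Hom₂.left_unitor f)) (Hom₂.id f)
  | right_unitor_hom_inv {a b : B} (f : Hom a b) :
      Rel ((Hom₂.right_unitor f).vcomp (Hom₂.right_unitor_inv f)) (Hom₂.id (f.comp (Hom.id b)))
  | right_unitor_inv_hom {a b : B} (f : Hom a b) :
      Rel ((Hom₂.right_unitor_inv f).vcomp (Hom₂.right_unitor f)) (Hom₂.id f)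
  | pentagon {a b c d e : B} (f : Hom a b) (g : Hom b c) (h : Hom c d) (i : Hom d e) :
      Rel (((Hom₂.associator f g h).whisker_right i).vcomp
          ((Hom₂.associator f (g.comp h) i).vcomp ((Hom₂.associator g h i).whisker_left f)))
        ((Hom₂.associator (f.comp g) h i).vcomp (Hom₂.associator f g (h.comp i)))
  | triangle {a b c : B} (f : Hom a b) (g : Hom b c) :
      Rel ((Hom₂.associator f (Hom.id b) g).vcomp ((Hom₂.left_unitor g).whisker_left f))
        ((Hom₂.right_unitor f).whisker_right g)
  | app_id {a b : B} (w : a ⟶ b) : Rel (Hom₂.app (𝟙 w)) (Hom₂.id (Hom.app w))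
  | app_comp {a b : B} {w w' w'' : a ⟶ b} (η : w ⟶ w') (θ : w' ⟶ w'') :
      Rel (Hom₂.app (η ≫ θ)) ((Hom₂.app η).vcomp (Hom₂.app θ))
  | unit_hom_inv (a : B) : Rel ((Hom₂.unit a).vcomp (Hom₂.unit_inv a)) (Hom₂.id (Hom.id a))
  | unit_inv_hom (a : B) : Rel ((Hom₂.unit_inv a).vcomp (Hom₂.unit a)) (Hom₂.id (Hom.app (𝟙 a)))
  | mul_hom_inv {a b c : B} (w : a ⟶ b) (w' : b ⟶ c) :
      Rel ((Hom₂.mul w w').vcomp (Hom₂.mul_inv w w')) (Hom₂.id ((Hom.app w).comp (Hom.app w')))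
  | mul_inv_hom {a b c : B} (w : a ⟶ b) (w' : b ⟶ c) :
      Rel ((Hom₂.mul_inv w w').vcomp (Hom₂.mul w w')) (Hom₂.id (Hom.app (w ≫ w')))
  | mul_naturality_left {a b c : B} {w w' : a ⟶ b} (η : w ⟶ w') (x : b ⟶ c) :
      Rel ((Hom₂.mul w x).vcomp (Hom₂.app (η ▷ x)))
        (((Hom₂.app η).whisker_right (Hom.app x)).vcomp (Hom₂.mul w' x))
  | mul_naturality_right {a b c : B} (w : a ⟶ b) {x x' : b ⟶ c} (η : x ⟶ x') :
      Rel ((Hom₂.mul w x).vcomp (Hom₂.app (w ◁ η)))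
        (((Hom₂.app η).whisker_left (Hom.app w)).vcomp (Hom₂.mul w x'))
  | mul_assoc {a b c d : B} (w : a ⟶ b) (x : b ⟶ c) (y : c ⟶ d) :
      Rel (((Hom₂.mul w x).whisker_right (Hom.app y)).vcomp
          ((Hom₂.mul (w ≫ x) y).vcomp (Hom₂.app (α_ w x y).hom)))
        ((Hom₂.associator (Hom.app w) (Hom.app x) (Hom.app y)).vcomp
          (((Hom₂.mul x y).whisker_left (Hom.app w)).vcomp (Hom₂.mul w (x ≫ y))))
  | unit_mul {a b : B} (w : a ⟶ b) :
      Rel (((Hom₂.unit a).whisker_right (Hom.app w)).vcomp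
          ((Hom₂.mul (𝟙 a) w).vcomp (Hom₂.app (λ_ w).hom)))
        (Hom₂.left_unitor (Hom.app w))
  | mul_unit {a b : B} (w : a ⟶ b) :
      Rel (((Hom₂.unit b).whisker_left (Hom.app w)).vcomp
          ((Hom₂.mul w (𝟙 b)).vcomp (Hom₂.app (ρ_ w).hom)))
        (Hom₂.right_unitor (Hom.app w))

instance homCategory (a b : PseudoTarget B) : Category.{max u₁ v₁ w₁} (a ⟶ b) where
  Hom f g := Quot (@Rel B _ a b f g)
  id f := Quot.mk _ (Hom₂.id f)
  comp := @fun _ _ _ => Quot.map₂ Hom₂.vcomp Rel.vcomp_right Rel.vcomp_left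
  id_comp := by
    rintro f g ⟨η⟩
    exact Quot.sound (Rel.id_comp η)
  comp_id := by
    rintro f g ⟨η⟩
    exact Quot.sound (Rel.comp_id η)
  assoc := by
    rintro f g h i ⟨η⟩ ⟨θ⟩ ⟨ι⟩
    exact Quot.sound (Rel.assoc η θ ι)

instance bicategory : Bicategory.{max u₁ v₁ w₁} (PseudoTarget B) where
  homCategory := @fun (a b : B) => homCategory a b
  whiskerLeft := @fun _ _ _ f g h η => Quot.map (Hom₂.whisker_left f) (Rel.whisker_left f g h) η
  whiskerLeft_id := @fun _ _ _ f g => Quot.sound (Rel.whisker_left_id f g)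
  associator := @fun _ _ _ _ f g h =>
    { hom := Quot.mk Rel (Hom₂.associator f g h)
      inv := Quot.mk Rel (Hom₂.associator_inv f g h)
      hom_inv_id := Quot.sound (Rel.associator_hom_inv f g h)
      inv_hom_id := Quot.sound (Rel.associator_inv_hom f g h) }
  leftUnitor := @fun _ _ f =>
    { hom := Quot.mk Rel (Hom₂.left_unitor f)
      inv := Quot.mk Rel (Hom₂.left_unitor_inv f)
      hom_inv_id := Quot.sound (Rel.left_unitor_hom_inv f)
      inv_hom_id := Quot.sound (Rel.left_unitor_inv_hom f) }
  rightUnitor := @fun _ _ f =>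
    { hom := Quot.mk Rel (Hom₂.right_unitor f)
      inv := Quot.mk Rel (Hom₂.right_unitor_inv f)
      hom_inv_id := Quot.sound (Rel.right_unitor_hom_inv f)
      inv_hom_id := Quot.sound (Rel.right_unitor_inv_hom f) }
  whiskerLeft_comp := by
    rintro a b c f g h i ⟨η⟩ ⟨θ⟩
    exact Quot.sound (Rel.whisker_left_comp f η θ)
  id_whiskerLeft := by
    rintro a b f g ⟨η⟩
    exact Quot.sound (Rel.id_whisker_left η)
  comp_whiskerLeft := by
    rintro a b c d f g h h' ⟨η⟩
    exact Quot.sound (Rel.comp_whisker_left f g η)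
  whiskerRight := @fun _ _ _ f g η h => Quot.map (Hom₂.whisker_right h) (Rel.whisker_right f g h) η
  id_whiskerRight := @fun _ _ _ f g => Quot.sound (Rel.id_whisker_right f g)
  comp_whiskerRight := by
    rintro a b c f g h ⟨η⟩ ⟨θ⟩ i
    exact Quot.sound (Rel.comp_whisker_right i η θ)
  whiskerRight_id := by
    rintro a b f g ⟨η⟩
    exact Quot.sound (Rel.whisker_right_id η)
  whiskerRight_comp := by
    rintro a b c d f f' ⟨η⟩ g h
    exact Quot.sound (Rel.whisker_right_comp g h η)
  whisker_assoc := by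
    rintro a b c d f g g' ⟨η⟩ h
    exact Quot.sound (Rel.whisker_assoc f η h)
  whisker_exchange := by
    rintro a b c f g h i ⟨η⟩ ⟨θ⟩
    exact Quot.sound (Rel.whisker_exchange η θ)
  pentagon := @fun _ _ _ _ _ f g h i => Quot.sound (Rel.pentagon f g h i)
  triangle := @fun _ _ _ f g => Quot.sound (Rel.triangle f g)

/-- A vertex of `B`, as a 0-cell of `PseudoTarget B`. -/
def vert (a : B) : PseudoTarget B := a

/-- The letter `F(w)`. -/
def letter {a b : B} (w : a ⟶ b) : vert a ⟶ vert b := Hom.app w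

/-- The 2-cell `F(η)`. -/
def letter₂ {a b : B} {w w' : a ⟶ b} (η : w ⟶ w') : letter w ⟶ letter w' :=
  Quot.mk _ (Hom₂.app η)

/-- The inverse of the unit `i`. -/
def unitIso (a : B) : letter (𝟙 a) ≅ 𝟙 (vert a) where
  hom := Quot.mk _ (Hom₂.unit_inv a)
  inv := Quot.mk _ (Hom₂.unit a)
  hom_inv_id := Quot.sound (Rel.unit_inv_hom a)
  inv_hom_id := Quot.sound (Rel.unit_hom_inv a)

/-- The inverse of the composition `m`. -/
def mulIso {a b c : B} (w : a ⟶ b) (w' : b ⟶ c) : letter (w ≫ w') ≅ letter w ≫ letter w' where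
  hom := Quot.mk _ (Hom₂.mul_inv w w')
  inv := Quot.mk _ (Hom₂.mul w w')
  hom_inv_id := Quot.sound (Rel.mul_inv_hom w w')
  inv_hom_id := Quot.sound (Rel.mul_hom_inv w w')

theorem mulIso_naturality_left {a b c : B} {w w' : a ⟶ b} (η : w ⟶ w') (x : b ⟶ c) :
    (mulIso w x).inv ≫ letter₂ (η ▷ x) = letter₂ η ▷ letter x ≫ (mulIso w' x).inv :=
  Quot.sound (Rel.mul_naturality_left η x)

theorem mulIso_naturality_right {a b c : B} (w : a ⟶ b) {x x' : b ⟶ c} (η : x ⟶ x') :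
    (mulIso w x).inv ≫ letter₂ (w ◁ η) = letter w ◁ letter₂ η ≫ (mulIso w x').inv :=
  Quot.sound (Rel.mul_naturality_right w η)

theorem mulIso_assoc {a b c d : B} (w : a ⟶ b) (x : b ⟶ c) (y : c ⟶ d) :
    (mulIso w x).inv ▷ letter y ≫ (mulIso (w ≫ x) y).inv ≫ letter₂ (α_ w x y).hom =
      (α_ (letter w) (letter x) (letter y)).hom ≫
        letter w ◁ (mulIso x y).inv ≫ (mulIso w (x ≫ y)).inv :=
  Quot.sound (Rel.mul_assoc w x y)

theorem unitIso_mulIso {a b : B} (w : a ⟶ b) :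
    (unitIso a).inv ▷ letter w ≫ (mulIso (𝟙 a) w).inv ≫ letter₂ (λ_ w).hom =
      (λ_ (letter w)).hom :=
  Quot.sound (Rel.unit_mul w)

theorem mulIso_unitIso {a b : B} (w : a ⟶ b) :
    letter w ◁ (unitIso b).inv ≫ (mulIso w (𝟙 b)).inv ≫ letter₂ (ρ_ w).hom =
      (ρ_ (letter w)).hom :=
  Quot.sound (Rel.mul_unit w)

variable (B) in
/-- The universal pseudofunctor out of `B`. -/
def incl : B ⥤ᵖ PseudoTarget B where
  obj a := vert a
  map w := letter w
  map₂ η := letter₂ η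
  map₂_id w := Quot.sound (Rel.app_id w)
  map₂_comp η θ := Quot.sound (Rel.app_comp η θ)
  mapId a := unitIso a
  mapComp w w' := mulIso w w'
  map₂_whisker_left w x x' η := by
    rw [← Iso.inv_comp_eq, mulIso_naturality_right]
  map₂_whisker_right η x := by
    rw [← Iso.inv_comp_eq, mulIso_naturality_left]
  map₂_associator w x y := by
    rw [← mulIso_assoc]
    simp
  map₂_left_unitor w := by
    rw [← unitIso_mulIso]
    simp
  map₂_right_unitor w := by
    rw [← mulIso_unitIso]
    simp

/-! The strict functor out of `PseudoTarget B` induced by a pseudofunctor out of `B`. -/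

variable {D : Type u₃} [Bicategory.{w₃, v₃} D] (K : B ⥤ᵖ D)

/-- The strict functor on 1-cells: `F(w) ↦ K w`. -/
def liftHom : ∀ {a b : B}, Hom a b → (K.obj a ⟶ K.obj b)
  | _, _, Hom.app w => K.map w
  | _, _, Hom.id a => 𝟙 (K.obj a)
  | _, _, Hom.comp f g => liftHom f ≫ liftHom g

/-- The strict functor on formal composites of 2-cells. -/
def liftHom₂ : ∀ {a b : B} {f g : Hom a b}, Hom₂ f g → (liftHom K f ⟶ liftHom K g)
  | _, _, _, _, Hom₂.id _ => 𝟙 _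
  | _, _, _, _, Hom₂.vcomp η θ => liftHom₂ η ≫ liftHom₂ θ
  | _, _, _, _, Hom₂.whisker_left f η => liftHom K f ◁ liftHom₂ η
  | _, _, _, _, Hom₂.whisker_right h η => liftHom₂ η ▷ liftHom K h
  | _, _, _, _, Hom₂.associator f g h => (α_ (liftHom K f) (liftHom K g) (liftHom K h)).hom
  | _, _, _, _, Hom₂.associator_inv f g h => (α_ (liftHom K f) (liftHom K g) (liftHom K h)).inv
  | _, _, _, _, Hom₂.right_unitor f => (ρ_ (liftHom K f)).hom
  | _, _, _, _, Hom₂.right_unitor_inv f => (ρ_ (liftHom K f)).inv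
  | _, _, _, _, Hom₂.left_unitor f => (λ_ (liftHom K f)).hom
  | _, _, _, _, Hom₂.left_unitor_inv f => (λ_ (liftHom K f)).inv
  | _, _, _, _, Hom₂.app η => K.map₂ η
  | _, _, _, _, Hom₂.unit a => (K.mapId a).inv
  | _, _, _, _, Hom₂.unit_inv a => (K.mapId a).hom
  | _, _, _, _, Hom₂.mul w w' => (K.mapComp w w').inv
  | _, _, _, _, Hom₂.mul_inv w w' => (K.mapComp w w').hom

theorem map_mul_naturality_left {a b c : B} {w w' : a ⟶ b} (η : w ⟶ w') (x : b ⟶ c) :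
    (K.mapComp w x).inv ≫ K.map₂ (η ▷ x) = K.map₂ η ▷ K.map x ≫ (K.mapComp w' x).inv := by
  simp

theorem map_mul_naturality_right {a b c : B} (w : a ⟶ b) {x x' : b ⟶ c} (η : x ⟶ x') :
    (K.mapComp w x).inv ≫ K.map₂ (w ◁ η) = K.map w ◁ K.map₂ η ≫ (K.mapComp w x').inv := by
  simp

theorem map_mul_assoc {a b c d : B} (w : a ⟶ b) (x : b ⟶ c) (y : c ⟶ d) :
    (K.mapComp w x).inv ▷ K.map y ≫ (K.mapComp (w ≫ x) y).inv ≫ K.map₂ (α_ w x y).hom =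
      (α_ (K.map w) (K.map x) (K.map y)).hom ≫
        K.map w ◁ (K.mapComp x y).inv ≫ (K.mapComp w (x ≫ y)).inv := by
  simp

theorem map_unit_mul {a b : B} (w : a ⟶ b) :
    (K.mapId a).inv ▷ K.map w ≫ (K.mapComp (𝟙 a) w).inv ≫ K.map₂ (λ_ w).hom =
      (λ_ (K.map w)).hom := by
  simp

theorem map_mul_unit {a b : B} (w : a ⟶ b) :
    K.map w ◁ (K.mapId b).inv ≫ (K.mapComp w (𝟙 b)).inv ≫ K.map₂ (ρ_ w).hom =
      (ρ_ (K.map w)).hom := by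
  simp

theorem liftHom₂_congr {a b : B} {f g : Hom a b} {η θ : Hom₂ f g} (H : Rel η θ) :
    liftHom₂ K η = liftHom₂ K θ := by
  induction H with
  | vcomp_right η _ _ _ h => exact congrArg (liftHom₂ K η ≫ ·) h
  | vcomp_left _ _ _ _ h => exact congrArg (· ≫ _) h
  | id_comp => exact Category.id_comp _
  | comp_id => exact Category.comp_id _
  | assoc => exact Category.assoc _ _ _
  | whisker_left f _ _ _ _ _ h => exact congrArg (liftHom K f ◁ ·) h
  | whisker_left_id => exact whiskerLeft_id _ _
  | whisker_left_comp => exact whiskerLeft_comp _ _ _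
  | id_whisker_left => exact id_whiskerLeft _
  | comp_whisker_left => exact comp_whiskerLeft _ _ _
  | whisker_right _ _ g _ _ _ h => exact congrArg (· ▷ liftHom K g) h
  | id_whisker_right => exact id_whiskerRight _ _
  | comp_whisker_right => exact comp_whiskerRight _ _ _
  | whisker_right_id => exact whiskerRight_id _
  | whisker_right_comp => exact whiskerRight_comp _ _ _
  | whisker_assoc => exact Bicategory.whisker_assoc _ _ _
  | whisker_exchange => exact Bicategory.whisker_exchange _ _
  | associator_hom_inv => exact Iso.hom_inv_id _
  | associator_inv_hom => exact Iso.inv_hom_id _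
  | left_unitor_hom_inv => exact Iso.hom_inv_id _
  | left_unitor_inv_hom => exact Iso.inv_hom_id _
  | right_unitor_hom_inv => exact Iso.hom_inv_id _
  | right_unitor_inv_hom => exact Iso.inv_hom_id _
  | pentagon => exact Bicategory.pentagon _ _ _ _
  | triangle => exact Bicategory.triangle _ _
  | app_id w => exact K.map₂_id w
  | app_comp η θ => exact K.map₂_comp η θ
  | unit_hom_inv a => exact (K.mapId a).inv_hom_id
  | unit_inv_hom a => exact (K.mapId a).hom_inv_id
  | mul_hom_inv w w' => exact (K.mapComp w w').inv_hom_id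
  | mul_inv_hom w w' => exact (K.mapComp w w').hom_inv_id
  | mul_naturality_left η x => exact map_mul_naturality_left K η x
  | mul_naturality_right w η => exact map_mul_naturality_right K w η
  | mul_assoc w x y => exact map_mul_assoc K w x y
  | unit_mul w => exact map_unit_mul K w
  | mul_unit w => exact map_mul_unit K w

/-- The strict functor out of `PseudoTarget B` induced by a pseudofunctor out of `B`. -/
def lift : PseudoTarget B ⥤ᵖ D where
  obj a := K.obj a
  map f := liftHom K f
  map₂ := Quot.lift (liftHom₂ K) fun _ _ H => liftHom₂_congr K H
  map₂_id _ := rfl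
  map₂_comp := by
    rintro a b f g h ⟨η⟩ ⟨θ⟩
    rfl
  mapId _ := Iso.refl _
  mapComp _ _ := Iso.refl _
  map₂_whisker_left := by
    rintro a b c f g h ⟨η⟩
    exact ((Category.id_comp _).trans (Category.comp_id _)).symm
  map₂_whisker_right := by
    rintro a b c f g ⟨η⟩ h
    exact ((Category.id_comp _).trans (Category.comp_id _)).symm
  map₂_associator f g h :=
    have e {a b c d : D} (f : a ⟶ b) (g : b ⟶ c) (h : c ⟶ d) : (α_ f g h).hom =
      𝟙 _ ≫ 𝟙 (f ≫ g) ▷ h ≫ (α_ f g h).hom ≫ f ◁ 𝟙 (g ≫ h) ≫ 𝟙 _ := by simp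
    e (liftHom K f) (liftHom K g) (liftHom K h)
  map₂_left_unitor f :=
    have e {a b : D} (f : a ⟶ b) : (λ_ f).hom = 𝟙 _ ≫ 𝟙 (𝟙 a) ▷ f ≫ (λ_ f).hom := by simp
    e (liftHom K f)
  map₂_right_unitor f :=
    have e {a b : D} (f : a ⟶ b) : (ρ_ f).hom = 𝟙 _ ≫ f ◁ 𝟙 (𝟙 b) ≫ (ρ_ f).hom := by simp
    e (liftHom K f)

end

end PseudoTarget

/-! ### The free shadow on a bicategory -/

/-- The objects of the free shadow category of `B`: endomorphism 1-cells `⟨⟨f⟩⟩` of `B`. -/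
structure FreeShadow (B : Type u₁) [Bicategory.{w₁, v₁} B] : Type max u₁ v₁ where
  {base : B}
  word : base ⟶ base

namespace FreeShadow

variable {B : Type u₁} [Bicategory.{w₁, v₁} B]

/-- Formal composites of the generating morphisms: 2-cells of `B` and rotators. -/
inductive Term : FreeShadow B → FreeShadow B → Type max u₁ v₁ w₁
  | id (x : FreeShadow B) : Term x x
  | comp {x y z : FreeShadow B} (p : Term x y) (q : Term y z) : Term x z
  | sh {a : B} {f g : a ⟶ a} (η : f ⟶ g) : Term ⟨f⟩ ⟨g⟩
  | rot {a b : B} (f : a ⟶ b) (g : b ⟶ a) : Term ⟨f ≫ g⟩ ⟨g ≫ f⟩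
  | rot_inv {a b : B} (f : a ⟶ b) (g : b ⟶ a) : Term ⟨g ≫ f⟩ ⟨f ≫ g⟩

/-- Relations: the axioms of a category, functoriality of `⟨⟨-⟩⟩`, and the axioms of a shadow. -/
inductive Rel : ∀ {x y : FreeShadow B}, Term x y → Term x y → Prop
  | comp_right {x y z : FreeShadow B} (p : Term x y) (q q' : Term y z) :
      Rel q q' → Rel (p.comp q) (p.comp q')
  | comp_left {x y z : FreeShadow B} (p p' : Term x y) (q : Term y z) :
      Rel p p' → Rel (p.comp q) (p'.comp q)
  | id_comp {x y : FreeShadow B} (p : Term x y) : Rel ((Term.id x).comp p) p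
  | comp_id {x y : FreeShadow B} (p : Term x y) : Rel (p.comp (Term.id y)) p
  | assoc {x y z t : FreeShadow B} (p : Term x y) (q : Term y z) (r : Term z t) :
      Rel ((p.comp q).comp r) (p.comp (q.comp r))
  | sh_id {a : B} (f : a ⟶ a) : Rel (Term.sh (𝟙 f)) (Term.id ⟨f⟩)
  | sh_comp {a : B} {f g h : a ⟶ a} (η : f ⟶ g) (θ : g ⟶ h) :
      Rel (Term.sh (η ≫ θ)) ((Term.sh η).comp (Term.sh θ))
  | rot_hom_inv {a b : B} (f : a ⟶ b) (g : b ⟶ a) :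
      Rel ((Term.rot f g).comp (Term.rot_inv f g)) (Term.id _)
  | rot_inv_hom {a b : B} (f : a ⟶ b) (g : b ⟶ a) :
      Rel ((Term.rot_inv f g).comp (Term.rot f g)) (Term.id _)
  | rot_naturality_left {a b : B} {f f' : a ⟶ b} (η : f ⟶ f') (g : b ⟶ a) :
      Rel ((Term.sh (η ▷ g)).comp (Term.rot f' g)) ((Term.rot f g).comp (Term.sh (g ◁ η)))
  | rot_naturality_right {a b : B} (f : a ⟶ b) {g g' : b ⟶ a} (η : g ⟶ g') :
      Rel ((Term.sh (f ◁ η)).comp (Term.rot f g')) ((Term.rot f g).comp (Term.sh (η ▷ f)))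
  | rot_assoc {a b c : B} (f : a ⟶ b) (g : b ⟶ c) (h : c ⟶ a) :
      Rel ((Term.rot (f ≫ g) h).comp ((Term.sh (α_ h f g).inv).comp (Term.rot (h ≫ f) g)))
        ((Term.sh (α_ f g h).hom).comp ((Term.rot f (g ≫ h)).comp (Term.sh (α_ g h f).hom)))
  | rot_unit_right {a : B} (f : a ⟶ a) :
      Rel ((Term.rot f (𝟙 a)).comp (Term.sh (λ_ f).hom)) (Term.sh (ρ_ f).hom)
  | rot_unit_left {a : B} (f : a ⟶ a) :
      Rel ((Term.rot (𝟙 a) f).comp (Term.sh (ρ_ f).hom)) (Term.sh (λ_ f).hom)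

instance category : Category.{max u₁ v₁ w₁} (FreeShadow B) where
  Hom x y := Quot (@Rel B _ x y)
  id x := Quot.mk _ (Term.id x)
  comp := @fun _ _ _ => Quot.map₂ Term.comp Rel.comp_right Rel.comp_left
  id_comp := by
    rintro x y ⟨p⟩
    exact Quot.sound (Rel.id_comp p)
  comp_id := by
    rintro x y ⟨p⟩
    exact Quot.sound (Rel.comp_id p)
  assoc := by
    rintro x y z t ⟨p⟩ ⟨q⟩ ⟨r⟩
    exact Quot.sound (Rel.assoc p q r)

variable (B) in
/-- The universal shadow on `B`. -/
def shadow : Shadow B (FreeShadow B) where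
  sh _ :=
    { obj := fun f => ⟨f⟩
      map := fun η => Quot.mk _ (Term.sh η)
      map_id := fun f => Quot.sound (Rel.sh_id f)
      map_comp := fun η θ => Quot.sound (Rel.sh_comp η θ) }
  θ f g :=
    { hom := Quot.mk _ (Term.rot f g)
      inv := Quot.mk _ (Term.rot_inv f g)
      hom_inv_id := Quot.sound (Rel.rot_hom_inv f g)
      inv_hom_id := Quot.sound (Rel.rot_inv_hom f g) }
  θ_naturality_left η g := Quot.sound (Rel.rot_naturality_left η g)
  θ_naturality_right f _ _ η := Quot.sound (Rel.rot_naturality_right f η)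
  θ_assoc f g h := Quot.sound (Rel.rot_assoc f g h)
  θ_unit_right f := Quot.sound (Rel.rot_unit_right f)
  θ_unit_left f := Quot.sound (Rel.rot_unit_left f)

variable {T : Type u₂} [Category.{v₂} T] (S : Shadow B T)

/-- The functor out of the free shadow category on formal composites. -/
def liftTerm : ∀ {x y : FreeShadow B}, Term x y → ((S.sh x.base).obj x.word ⟶
    (S.sh y.base).obj y.word)
  | _, _, Term.id _ => 𝟙 _
  | _, _, Term.comp p q => liftTerm p ≫ liftTerm q
  | _, _, Term.sh η => (S.sh _).map η
  | _, _, Term.rot f g => (S.θ f g).hom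
  | _, _, Term.rot_inv f g => (S.θ f g).inv

theorem liftTerm_congr {x y : FreeShadow B} {p q : Term x y} (H : Rel p q) :
    liftTerm S p = liftTerm S q := by
  induction H with
  | comp_right p _ _ _ h => exact congrArg (liftTerm S p ≫ ·) h
  | comp_left _ _ q _ h => exact congrArg (· ≫ liftTerm S q) h
  | id_comp => exact Category.id_comp _
  | comp_id => exact Category.comp_id _
  | assoc => exact Category.assoc _ _ _
  | sh_id f => exact (S.sh _).map_id f
  | sh_comp η θ => exact (S.sh _).map_comp η θ
  | rot_hom_inv f g => exact (S.θ f g).hom_inv_id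
  | rot_inv_hom f g => exact (S.θ f g).inv_hom_id
  | rot_naturality_left η g => exact S.θ_naturality_left η g
  | rot_naturality_right f η => exact S.θ_naturality_right f η
  | rot_assoc f g h => exact S.θ_assoc f g h
  | rot_unit_right f => exact S.θ_unit_right f
  | rot_unit_left f => exact S.θ_unit_left f

/-- The functor `⟨⟨f⟩⟩ ↦ S.sh f` out of the free shadow category induced by a shadow on `B`. -/
def lift : FreeShadow B ⥤ T where
  obj x := (S.sh x.base).obj x.word
  map := Quot.lift (liftTerm S) fun _ _ H => liftTerm_congr S H
  map_id _ := rfl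
  map_comp := by
    rintro x y z ⟨p⟩ ⟨q⟩
    rfl

end FreeShadow

/-! ### The free shadow category receiving a strong shadow functor -/

section

variable {B : Type u₁} [Bicategory.{w₁, v₁} B] {T : Type u₂} [Category.{v₂} T]
  {B' : Type u₃} [Bicategory.{w₃, v₃} B']

/-- Given a pseudofunctor `F : B ⥤ᵖ B'` and a shadow `S` on `B` with values in `T`, the objects of
the free shadow category of `B'` receiving a strong shadow functor over `F`: objects `H x` for `x`
in `T`, and endomorphism 1-cells `⟨⟨f⟩⟩` of `B'`. -/
inductive ShadowTarget (F : B ⥤ᵖ B') (S : Shadow B T) : Type max u₂ u₃ v₃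
  | app (x : T) : ShadowTarget F S
  | sh {a : B'} (f : a ⟶ a) : ShadowTarget F S

namespace ShadowTarget

variable {F : B ⥤ᵖ B'} {S : Shadow B T}

/-- Formal composites of the generating morphisms: morphisms of `T` inside `H(-)`, 2-cells of `B'`,
rotators for `B'`, and the shadow commutators. -/
inductive Term : ShadowTarget F S → ShadowTarget F S → Type max u₁ v₁ u₂ v₂ u₃ v₃ w₃
  | id (x : ShadowTarget F S) : Term x x
  | comp {x y z : ShadowTarget F S} (p : Term x y) (q : Term y z) : Term x z
  | app {x y : T} (φ : x ⟶ y) : Term (.app x) (.app y)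
  | sh {a : B'} {f g : a ⟶ a} (η : f ⟶ g) : Term (.sh f) (.sh g)
  | rot {a b : B'} (f : a ⟶ b) (g : b ⟶ a) : Term (.sh (f ≫ g)) (.sh (g ≫ f))
  | rot_inv {a b : B'} (f : a ⟶ b) (g : b ⟶ a) : Term (.sh (g ≫ f)) (.sh (f ≫ g))
  | s {a : B} (f : a ⟶ a) : Term (.sh (F.map f)) (.app ((S.sh a).obj f))
  | s_inv {a : B} (f : a ⟶ a) : Term (.app ((S.sh a).obj f)) (.sh (F.map f))

/-- Relations: the axioms of a category, functoriality of `H` and of `⟨⟨-⟩⟩`, the axioms of a shadow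
on `B'`, and the axioms of a strong shadow functor. -/
inductive Rel : ∀ {x y : ShadowTarget F S}, Term x y → Term x y → Prop
  | comp_right {x y z : ShadowTarget F S} (p : Term x y) (q q' : Term y z) :
      Rel q q' → Rel (p.comp q) (p.comp q')
  | comp_left {x y z : ShadowTarget F S} (p p' : Term x y) (q : Term y z) :
      Rel p p' → Rel (p.comp q) (p'.comp q)
  | id_comp {x y : ShadowTarget F S} (p : Term x y) : Rel ((Term.id x).comp p) p
  | comp_id {x y : ShadowTarget F S} (p : Term x y) : Rel (p.comp (Term.id y)) p
  | assoc {x y z t : ShadowTarget F S} (p : Term x y) (q : Term y z) (r : Term z t) :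
      Rel ((p.comp q).comp r) (p.comp (q.comp r))
  | app_id (x : T) : Rel (Term.app (𝟙 x)) (Term.id (.app x))
  | app_comp {x y z : T} (φ : x ⟶ y) (ψ : y ⟶ z) :
      Rel (Term.app (φ ≫ ψ)) ((Term.app φ).comp (Term.app ψ))
  | sh_id {a : B'} (f : a ⟶ a) : Rel (Term.sh (𝟙 f)) (Term.id (.sh f))
  | sh_comp {a : B'} {f g h : a ⟶ a} (η : f ⟶ g) (θ : g ⟶ h) :
      Rel (Term.sh (η ≫ θ)) ((Term.sh η).comp (Term.sh θ))
  | rot_hom_inv {a b : B'} (f : a ⟶ b) (g : b ⟶ a) :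
      Rel ((Term.rot f g).comp (Term.rot_inv f g)) (Term.id _)
  | rot_inv_hom {a b : B'} (f : a ⟶ b) (g : b ⟶ a) :
      Rel ((Term.rot_inv f g).comp (Term.rot f g)) (Term.id _)
  | rot_naturality_left {a b : B'} {f f' : a ⟶ b} (η : f ⟶ f') (g : b ⟶ a) :
      Rel ((Term.sh (η ▷ g)).comp (Term.rot f' g)) ((Term.rot f g).comp (Term.sh (g ◁ η)))
  | rot_naturality_right {a b : B'} (f : a ⟶ b) {g g' : b ⟶ a} (η : g ⟶ g') :
      Rel ((Term.sh (f ◁ η)).comp (Term.rot f g')) ((Term.rot f g).comp (Term.sh (η ▷ f)))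
  | rot_assoc {a b c : B'} (f : a ⟶ b) (g : b ⟶ c) (h : c ⟶ a) :
      Rel ((Term.rot (f ≫ g) h).comp ((Term.sh (α_ h f g).inv).comp (Term.rot (h ≫ f) g)))
        ((Term.sh (α_ f g h).hom).comp ((Term.rot f (g ≫ h)).comp (Term.sh (α_ g h f).hom)))
  | rot_unit_right {a : B'} (f : a ⟶ a) :
      Rel ((Term.rot f (𝟙 a)).comp (Term.sh (λ_ f).hom)) (Term.sh (ρ_ f).hom)
  | rot_unit_left {a : B'} (f : a ⟶ a) :
      Rel ((Term.rot (𝟙 a) f).comp (Term.sh (ρ_ f).hom)) (Term.sh (λ_ f).hom)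
  | s_hom_inv {a : B} (f : a ⟶ a) : Rel ((Term.s f).comp (Term.s_inv f)) (Term.id _)
  | s_inv_hom {a : B} (f : a ⟶ a) : Rel ((Term.s_inv f).comp (Term.s f)) (Term.id _)
  | s_naturality {a : B} {f g : a ⟶ a} (η : f ⟶ g) :
      Rel ((Term.sh (F.map₂ η)).comp (Term.s g)) ((Term.s f).comp (Term.app ((S.sh a).map η)))
  | s_rot {a b : B} (f : a ⟶ b) (g : b ⟶ a) :
      Rel ((Term.rot (F.map f) (F.map g)).comp
          ((Term.sh (F.mapComp g f).inv).comp (Term.s (g ≫ f))))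
        ((Term.sh (F.mapComp f g).inv).comp
          ((Term.s (f ≫ g)).comp (Term.app (S.θ f g).hom)))

instance category : Category.{max u₁ v₁ u₂ v₂ u₃ v₃ w₃} (ShadowTarget F S) where
  Hom x y := Quot (@Rel B _ T _ B' _ F S x y)
  id x := Quot.mk _ (Term.id x)
  comp := @fun _ _ _ => Quot.map₂ Term.comp Rel.comp_right Rel.comp_left
  id_comp := by
    rintro x y ⟨p⟩
    exact Quot.sound (Rel.id_comp p)
  comp_id := by
    rintro x y ⟨p⟩
    exact Quot.sound (Rel.comp_id p)
  assoc := by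
    rintro x y z t ⟨p⟩ ⟨q⟩ ⟨r⟩
    exact Quot.sound (Rel.assoc p q r)

variable (F S) in
/-- The universal shadow on `B'` receiving a strong shadow functor over `F`. -/
def shadow : Shadow B' (ShadowTarget F S) where
  sh _ :=
    { obj := fun f => .sh f
      map := fun η => Quot.mk _ (Term.sh η)
      map_id := fun f => Quot.sound (Rel.sh_id f)
      map_comp := fun η θ => Quot.sound (Rel.sh_comp η θ) }
  θ f g :=
    { hom := Quot.mk _ (Term.rot f g)
      inv := Quot.mk _ (Term.rot_inv f g)
      hom_inv_id := Quot.sound (Rel.rot_hom_inv f g)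
      inv_hom_id := Quot.sound (Rel.rot_inv_hom f g) }
  θ_naturality_left η g := Quot.sound (Rel.rot_naturality_left η g)
  θ_naturality_right f _ _ η := Quot.sound (Rel.rot_naturality_right f η)
  θ_assoc f g h := Quot.sound (Rel.rot_assoc f g h)
  θ_unit_right f := Quot.sound (Rel.rot_unit_right f)
  θ_unit_left f := Quot.sound (Rel.rot_unit_left f)

variable (F S) in
/-- The universal strong shadow functor over `F`. -/
def incl : StrongShadowFunctor S (shadow F S) where
  F := F
  H :=
    { obj := fun x => .app x
      map := fun φ => Quot.mk _ (Term.app φ)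
      map_id := fun x => Quot.sound (Rel.app_id x)
      map_comp := fun φ ψ => Quot.sound (Rel.app_comp φ ψ) }
  s f :=
    { hom := Quot.mk _ (Term.s f)
      inv := Quot.mk _ (Term.s_inv f)
      hom_inv_id := Quot.sound (Rel.s_hom_inv f)
      inv_hom_id := Quot.sound (Rel.s_inv_hom f) }
  s_naturality η := Quot.sound (Rel.s_naturality η)
  s_θ f g := Quot.sound (Rel.s_rot f g)

variable {T' : Type u₄} [Category.{v₄} T'] {S' : Shadow B' T'} (Φ : StrongShadowFunctor S S')

/-- The functor out of `ShadowTarget Φ.F S` on objects. -/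
def liftObj : ShadowTarget Φ.F S → T'
  | .app x => Φ.H.obj x
  | .sh f => (S'.sh _).obj f

/-- The functor out of `ShadowTarget Φ.F S` on formal composites. -/
def liftTerm : ∀ {x y : ShadowTarget Φ.F S}, Term x y → (liftObj Φ x ⟶ liftObj Φ y)
  | _, _, Term.id _ => 𝟙 _
  | _, _, Term.comp p q => liftTerm p ≫ liftTerm q
  | _, _, Term.app φ => Φ.H.map φ
  | _, _, Term.sh η => (S'.sh _).map η
  | _, _, Term.rot f g => (S'.θ f g).hom
  | _, _, Term.rot_inv f g => (S'.θ f g).inv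
  | _, _, Term.s f => (Φ.s f).hom
  | _, _, Term.s_inv f => (Φ.s f).inv

theorem liftTerm_congr {x y : ShadowTarget Φ.F S} {p q : Term x y} (h : Rel p q) :
    liftTerm Φ p = liftTerm Φ q := by
  induction h with
  | comp_right p _ _ _ h => exact congrArg (liftTerm Φ p ≫ ·) h
  | comp_left _ _ q _ h => exact congrArg (· ≫ liftTerm Φ q) h
  | id_comp => exact Category.id_comp _
  | comp_id => exact Category.comp_id _
  | assoc => exact Category.assoc _ _ _
  | app_id x => exact Φ.H.map_id x
  | app_comp φ ψ => exact Φ.H.map_comp φ ψ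
  | sh_id f => exact (S'.sh _).map_id f
  | sh_comp η θ => exact (S'.sh _).map_comp η θ
  | rot_hom_inv f g => exact (S'.θ f g).hom_inv_id
  | rot_inv_hom f g => exact (S'.θ f g).inv_hom_id
  | rot_naturality_left η g => exact S'.θ_naturality_left η g
  | rot_naturality_right f η => exact S'.θ_naturality_right f η
  | rot_assoc f g h => exact S'.θ_assoc f g h
  | rot_unit_right f => exact S'.θ_unit_right f
  | rot_unit_left f => exact S'.θ_unit_left f
  | s_hom_inv f => exact (Φ.s f).hom_inv_id
  | s_inv_hom f => exact (Φ.s f).inv_hom_id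
  | s_naturality η => exact Φ.s_naturality η
  | s_rot f g => exact Φ.s_θ f g

/-- The functor out of `ShadowTarget Φ.F S` induced by a strong shadow functor `Φ`. -/
def lift : ShadowTarget Φ.F S ⥤ T' where
  obj := liftObj Φ
  map := Quot.lift (liftTerm Φ) fun _ _ h => liftTerm_congr Φ h
  map_id _ := rfl
  map_comp := by
    rintro x y z ⟨p⟩ ⟨q⟩
    rfl

end ShadowTarget

end

/-! ### The free strong shadow functor on a quiver, and its evaluation -/

section

variable (G : Type u) [Quiver.{v} G]

/-- The source shadow of the free strong shadow functor on `G`: the free bicategory on `G` with its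
free shadow. -/
abbrev freeSource : Shadow (FreeBicategory G) (FreeShadow (FreeBicategory G)) :=
  FreeShadow.shadow (FreeBicategory G)

/-- The shadow category of the target of the free strong shadow functor on `G`. Its morphisms are
the formal morphisms. -/
abbrev FormalShadow : Type max u v :=
  ShadowTarget (PseudoTarget.incl (FreeBicategory G)) (freeSource G)

/-- The target shadow of the free strong shadow functor on `G`. -/
abbrev freeTarget : Shadow (PseudoTarget (FreeBicategory G)) (FormalShadow G) :=
  ShadowTarget.shadow (PseudoTarget.incl (FreeBicategory G)) (freeSource G)

/-- The free strong shadow functor on `G`. -/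
abbrev freeStrongShadowFunctor : StrongShadowFunctor (freeSource G) (freeTarget G) :=
  ShadowTarget.incl (PseudoTarget.incl (FreeBicategory G)) (freeSource G)

end

section

variable {C : Type u₁} [Bicategory.{w₁, v₁} C] {T : Type u₂} [Category.{v₂} T]
  {D : Type u₃} [Bicategory.{w₃, v₃} D] {T' : Type u₄} [Category.{v₄} T']
  {S : Shadow C T} {S' : Shadow D T'}

variable (C) in
/-- The counit: the strict functor from the free bicategory on the 0-cells and 1-cells of `C`. -/
abbrev counit : FreeBicategory C ⥤ᵖ C := FreeBicategory.lift (Prefunctor.id C)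

/-- The strict functor from the target of the free pseudofunctor on the 0-cells and 1-cells of `C`
to `D` induced by a pseudofunctor `F : C ⥤ᵖ D`. -/
abbrev counitTarget (F : C ⥤ᵖ D) : PseudoTarget (FreeBicategory C) ⥤ᵖ D :=
  PseudoTarget.lift ((counit C).comp F)

theorem StrongShadowFunctor.s_θ_aux (Φ : StrongShadowFunctor S S') {a b : C} (f : a ⟶ b)
    (g : b ⟶ a) :
    ((S'.sh (Φ.F.obj a)).map (𝟙 (Φ.F.map f ≫ Φ.F.map g)) ≫ (S'.θ (Φ.F.map f) (Φ.F.map g)).hom ≫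
      (S'.sh (Φ.F.obj b)).map (𝟙 (Φ.F.map g ≫ Φ.F.map f))) ≫
      (S'.sh (Φ.F.obj b)).map ((Φ.F.mapComp g f).inv ≫ Φ.F.map₂ (𝟙 (g ≫ f))) ≫
      (Φ.s (g ≫ f)).hom =
    (S'.sh (Φ.F.obj a)).map ((Φ.F.mapComp f g).inv ≫ Φ.F.map₂ (𝟙 (f ≫ g))) ≫
      (Φ.s (f ≫ g)).hom ≫ Φ.H.map ((S.sh a).map (𝟙 (f ≫ g)) ≫ (S.θ f g).hom ≫
        (S.sh b).map (𝟙 (g ≫ f))) := by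
  simp only [CategoryTheory.Functor.map_id, Category.id_comp, Category.comp_id, Φ.F.map₂_id]
  exact Φ.s_θ f g

/-- The comparison of a strong shadow functor with the free one: `⟨⟨F(w)⟩⟩ ≅ H⟨⟨w⟩⟩` is
interpreted by `s`. -/
def StrongShadowFunctor.interpretation (Φ : StrongShadowFunctor S S') :
    StrongShadowFunctor (freeSource C) (S'.pullback (counitTarget Φ.F)) where
  F := PseudoTarget.incl (FreeBicategory C)
  H := FreeShadow.lift (S.pullback (counit C)) ⋙ Φ.H
  s f := Φ.s ((counit C).map f)
  s_naturality η := Φ.s_naturality ((counit C).map₂ η)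
  s_θ f g := Φ.s_θ_aux ((counit C).map f) ((counit C).map g)

/-- The functor interpreting formal morphisms as morphisms of the target shadow category of a
strong shadow functor. -/
def StrongShadowFunctor.eval (Φ : StrongShadowFunctor S S') : FormalShadow C ⥤ T' :=
  ShadowTarget.lift Φ.interpretation

end

/-! ### Underlying cyclic permutations -/

section

variable {G : Type u} [Quiver.{v} G]

/-- The number `n` of edges `X₁, …, Xₙ` in a 1-cell of the free bicategory. -/
def len : ∀ {a b : G}, FreeBicategory.Hom a b → ℕ
  | _, _, .of _ => 1
  | _, _, .id _ => 0
  | _, _, .comp f g => len f + len g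

/-- The list of edges `X₁, …, Xₙ` in a 1-cell of the free bicategory. -/
def edges : ∀ {a b : G}, FreeBicategory.Hom a b → List (Quiver.Total G)
  | _, _, .of f => [⟨_, _, f⟩]
  | _, _, .id _ => []
  | _, _, .comp f g => edges f ++ edges g

/-- The number of edges in a 1-cell of the target of the free pseudofunctor. -/
def lenT : ∀ {a b : FreeBicategory G}, PseudoTarget.Hom a b → ℕ
  | _, _, .app w => len w
  | _, _, .id _ => 0
  | _, _, .comp f g => lenT f + lenT g

/-- The list of edges in a 1-cell of the target of the free pseudofunctor. -/
def edgesT : ∀ {a b : FreeBicategory G}, PseudoTarget.Hom a b → List (Quiver.Total G)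
  | _, _, .app w => edges w
  | _, _, .id _ => []
  | _, _, .comp f g => edgesT f ++ edgesT g

/-- The number of edges in an object of `FormalShadow G`. -/
def FormalShadow.len : FormalShadow G → ℕ
  | .app x => ShadowCoherence.len x.word
  | .sh f => lenT f

/-- The list of edges in an object of `FormalShadow G`. -/
def FormalShadow.edges : FormalShadow G → List (Quiver.Total G)
  | .app x => ShadowCoherence.edges x.word
  | .sh f => edgesT f

theorem hom₂_len_eq {a b : FreeBicategory G} {f g : a ⟶ b}
    (η : FreeBicategory.Hom₂ f g) : len f = len g := by
  induction η with
  | id => rfl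
  | vcomp _ _ h₁ h₂ => exact h₁.trans h₂
  | whisker_left f _ h => exact congrArg (len f + ·) h
  | whisker_right k _ h => exact congrArg (· + len k) h
  | associator => exact Nat.add_assoc _ _ _
  | associator_inv => exact (Nat.add_assoc _ _ _).symm
  | right_unitor => exact Nat.add_zero _
  | right_unitor_inv => exact (Nat.add_zero _).symm
  | left_unitor => exact Nat.zero_add _
  | left_unitor_inv => exact (Nat.zero_add _).symm

theorem len_eq {a b : FreeBicategory G} {f g : a ⟶ b} (η : f ⟶ g) : len f = len g := by
  obtain ⟨η⟩ := η
  exact hom₂_len_eq η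

theorem PseudoTarget.Hom₂.lenT_eq {a b : FreeBicategory G} {f g : PseudoTarget.Hom a b}
    (η : PseudoTarget.Hom₂ f g) : lenT f = lenT g := by
  induction η with
  | id => rfl
  | vcomp _ _ h₁ h₂ => exact h₁.trans h₂
  | whisker_left f _ h => exact congrArg (lenT f + ·) h
  | whisker_right k _ h => exact congrArg (· + lenT k) h
  | associator => exact Nat.add_assoc _ _ _
  | associator_inv => exact (Nat.add_assoc _ _ _).symm
  | right_unitor => exact Nat.add_zero _
  | right_unitor_inv => exact (Nat.add_zero _).symm
  | left_unitor => exact Nat.zero_add _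
  | left_unitor_inv => exact (Nat.zero_add _).symm
  | app η => exact len_eq η
  | unit => rfl
  | unit_inv => rfl
  | mul => rfl
  | mul_inv => rfl

theorem lenT_eq {a b : PseudoTarget (FreeBicategory G)} {f g : a ⟶ b} (η : f ⟶ g) :
    lenT f = lenT g := by
  obtain ⟨η⟩ := η
  exact PseudoTarget.Hom₂.lenT_eq η

/-- The cyclic permutation exchanging a first block of `m` positions with a second block of `n`
positions. -/
abbrev blockRotation (m n : ℕ) : Fin (m + n) ≃ Fin (n + m) := finAddFlip

theorem blockRotation_val {m n : ℕ} (i : Fin (m + n)) :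
    (blockRotation m n i : ℕ) = if (i : ℕ) < m then n + i else i - m := by
  obtain ⟨i, hi⟩ := i
  split_ifs with h
  · rw [blockRotation, finAddFlip_apply_mk_left h]
  · rw [blockRotation, finAddFlip_apply_mk_right (not_lt.mp h) hi]

theorem blockRotation_naturality_left {m m' n : ℕ} (h : m = m') (h₁ : m + n = m' + n)
    (h₂ : n + m = n + m') :
    (finCongr h₁).trans (blockRotation m' n) = (blockRotation m n).trans (finCongr h₂) := by
  subst h
  rfl

theorem blockRotation_naturality_right {m n n' : ℕ} (h : n = n') (h₁ : m + n = m + n')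
    (h₂ : n + m = n' + m) :
    (finCongr h₁).trans (blockRotation m n') = (blockRotation m n).trans (finCongr h₂) := by
  subst h
  rfl

theorem blockRotation_assoc (l m n : ℕ) (h₁ : n + (l + m) = n + l + m)
    (h₂ : l + m + n = l + (m + n)) (h₃ : m + n + l = m + (n + l)) :
    (blockRotation (l + m) n).trans ((finCongr h₁).trans (blockRotation (n + l) m)) =
      (finCongr h₂).trans ((blockRotation l (m + n)).trans (finCongr h₃)) := by
  ext i
  simp only [Equiv.trans_apply, blockRotation_val, finCongr_apply, Fin.val_cast]
  split_ifs <;> omega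

theorem blockRotation_zero_right (n : ℕ) (h₁ : 0 + n = n) (h₂ : n + 0 = n) :
    (blockRotation n 0).trans (finCongr h₁) = finCongr h₂ := by
  ext i
  simp only [Equiv.trans_apply, blockRotation_val, finCongr_apply, Fin.val_cast]
  split_ifs <;> omega

theorem blockRotation_zero_left (n : ℕ) (h₁ : n + 0 = n) (h₂ : 0 + n = n) :
    (blockRotation 0 n).trans (finCongr h₁) = finCongr h₂ := by
  ext i
  simp only [Equiv.trans_apply, blockRotation_val, finCongr_apply, Fin.val_cast]
  split_ifs <;> omega

/-- The underlying cyclic permutation of a formal composite in the free shadow category: a rotator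
`⟨⟨A ⊙ B⟩⟩ ⟶ ⟨⟨B ⊙ A⟩⟩` exchanges the edges of `A` with those of `B`, and 2-cells preserve
positions. -/
def sourcePermTerm : ∀ {x y : FreeShadow (FreeBicategory G)}, FreeShadow.Term x y →
    (Fin (len x.word) ≃ Fin (len y.word))
  | _, _, .id _ => Equiv.refl _
  | _, _, .comp p q => (sourcePermTerm p).trans (sourcePermTerm q)
  | _, _, .sh η => finCongr (len_eq η)
  | _, _, .rot f g => blockRotation (len f) (len g)
  | _, _, .rot_inv f g => (blockRotation (len f) (len g)).symm

theorem sourcePermTerm_congr {x y : FreeShadow (FreeBicategory G)} {p q : FreeShadow.Term x y}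
    (h : FreeShadow.Rel p q) : sourcePermTerm p = sourcePermTerm q := by
  induction h with
  | comp_right p _ _ _ h => exact congrArg ((sourcePermTerm p).trans ·) h
  | comp_left _ _ q _ h => exact congrArg (·.trans (sourcePermTerm q)) h
  | id_comp => rfl
  | comp_id => rfl
  | assoc => rfl
  | sh_id f => rfl
  | sh_comp η θ => rfl
  | rot_hom_inv f g => exact Equiv.self_trans_symm _
  | rot_inv_hom f g => exact Equiv.symm_trans_self _
  | rot_naturality_left η g => exact blockRotation_naturality_left (len_eq η) _ _
  | rot_naturality_right f η => exact blockRotation_naturality_right (len_eq η) _ _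
  | rot_assoc f g h => exact blockRotation_assoc (len f) (len g) (len h) _ _ _
  | rot_unit_right f => exact blockRotation_zero_right (len f) _ _
  | rot_unit_left f => exact blockRotation_zero_left (len f) _ _

/-- The underlying cyclic permutation of a morphism of the free shadow category. -/
def sourcePerm {x y : FreeShadow (FreeBicategory G)} (φ : x ⟶ y) :
    Fin (len x.word) ≃ Fin (len y.word) :=
  Quot.lift sourcePermTerm (fun _ _ h => sourcePermTerm_congr h) φ

/-- The underlying cyclic permutation of a formal composite of generating formal morphisms. -/
def permTerm : ∀ {x y : FormalShadow G}, ShadowTarget.Term x y → (Fin x.len ≃ Fin y.len)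
  | _, _, .id _ => Equiv.refl _
  | _, _, .comp p q => (permTerm p).trans (permTerm q)
  | _, _, .app φ => sourcePerm φ
  | _, _, .sh η => finCongr (lenT_eq η)
  | _, _, .rot f g => blockRotation (lenT f) (lenT g)
  | _, _, .rot_inv f g => (blockRotation (lenT f) (lenT g)).symm
  | _, _, .s f => Equiv.refl (Fin (len f))
  | _, _, .s_inv f => Equiv.refl (Fin (len f))

theorem permTerm_congr {x y : FormalShadow G} {p q : ShadowTarget.Term x y}
    (h : ShadowTarget.Rel p q) : permTerm p = permTerm q := by
  induction h with
  | comp_right p _ _ _ h => exact congrArg ((permTerm p).trans ·) h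
  | comp_left _ _ q _ h => exact congrArg (·.trans (permTerm q)) h
  | id_comp => rfl
  | comp_id => rfl
  | assoc => rfl
  | app_id x => rfl
  | app_comp φ ψ =>
    obtain ⟨φ⟩ := φ
    obtain ⟨ψ⟩ := ψ
    rfl
  | sh_id f => rfl
  | sh_comp η θ => rfl
  | rot_hom_inv f g => exact Equiv.self_trans_symm _
  | rot_inv_hom f g => exact Equiv.symm_trans_self _
  | rot_naturality_left η g => exact blockRotation_naturality_left (lenT_eq η) _ _
  | rot_naturality_right f η => exact blockRotation_naturality_right (lenT_eq η) _ _
  | rot_assoc f g h => exact blockRotation_assoc (lenT f) (lenT g) (lenT h) _ _ _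
  | rot_unit_right f => exact blockRotation_zero_right (lenT f) _ _
  | rot_unit_left f => exact blockRotation_zero_left (lenT f) _ _
  | s_hom_inv f => rfl
  | s_inv_hom f => rfl
  | s_naturality η => rfl
  | s_rot f g => rfl

/-- The underlying cyclic permutation `P(φ)` of the edges `X₁, …, Xₙ` induced by a formal
morphism `φ`. -/
def perm {x y : FormalShadow G} (φ : x ⟶ y) : Fin x.len ≃ Fin y.len :=
  Quot.lift permTerm (fun _ _ h => permTerm_congr h) φ

/-- A bijection of positions is a rotation if it shifts all positions by the same amount. -/
def IsRotation {m n : ℕ} (e : Fin m ≃ Fin n) : Prop :=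
  ∃ k : ℕ, ∀ i, (e i : ℕ) = (i + k) % n

theorem IsRotation.of_eq {m n : ℕ} (h : m = n) : IsRotation (finCongr h) :=
  ⟨0, fun i => (Nat.mod_eq_of_lt (h.subst (motive := fun t => (i : ℕ) < t) i.2)).symm⟩

theorem IsRotation.trans {l m n : ℕ} {e : Fin l ≃ Fin m} {e' : Fin m ≃ Fin n} (h : IsRotation e)
    (h' : IsRotation e') : IsRotation (e.trans e') := by
  obtain rfl : m = n := Fin.equiv_iff_eq.mp ⟨e'⟩
  obtain ⟨k, hk⟩ := h
  obtain ⟨k', hk'⟩ := h'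
  exact ⟨k + k', fun i => by simp [hk, hk', Nat.add_assoc]⟩

theorem isRotation_blockRotation (m n : ℕ) : IsRotation (blockRotation m n) := by
  refine ⟨n, fun i => ?_⟩
  have hi := i.2
  rw [blockRotation_val]
  split_ifs with h
  · rw [Nat.mod_eq_of_lt (by omega), Nat.add_comm]
  · rw [Nat.mod_eq_sub_mod (by omega), Nat.mod_eq_of_lt (by omega)]
    omega

theorem isRotation_blockRotation_symm (m n : ℕ) : IsRotation (blockRotation m n).symm := by
  have h : (blockRotation m n).symm = blockRotation n m := by
    refine Equiv.ext fun i => (Equiv.symm_apply_eq _).2 (Fin.ext ?_)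
    simp only [blockRotation_val]
    split_ifs <;> omega
  rw [h]
  exact isRotation_blockRotation n m

theorem isRotation_sourcePermTerm {x y : FreeShadow (FreeBicategory G)} (p : FreeShadow.Term x y) :
    IsRotation (sourcePermTerm p) := by
  induction p with
  | id x => exact .of_eq rfl
  | comp _ _ h h' => exact h.trans h'
  | sh η => exact .of_eq _
  | rot f g => exact isRotation_blockRotation _ _
  | rot_inv f g => exact isRotation_blockRotation_symm _ _

theorem isRotation_sourcePerm {x y : FreeShadow (FreeBicategory G)} (φ : x ⟶ y) :
    IsRotation (sourcePerm φ) := by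
  obtain ⟨p⟩ := φ
  exact isRotation_sourcePermTerm p

theorem isRotation_permTerm {x y : FormalShadow G} (p : ShadowTarget.Term x y) :
    IsRotation (permTerm p) := by
  induction p with
  | id x => exact .of_eq rfl
  | comp _ _ h h' => exact h.trans h'
  | app φ => exact isRotation_sourcePerm φ
  | sh η => exact .of_eq _
  | rot f g => exact isRotation_blockRotation _ _
  | rot_inv f g => exact isRotation_blockRotation_symm _ _
  | s f => exact .of_eq rfl
  | s_inv f => exact .of_eq rfl

/-- The permutations induced by formal morphisms are rotations, i.e. elements of the cyclic group
acting on the positions. -/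
theorem isRotation_perm {x y : FormalShadow G} (φ : x ⟶ y) : IsRotation (perm φ) := by
  obtain ⟨p⟩ := φ
  exact isRotation_permTerm p

/-- A list is aperiodic if no nontrivial rotation of its terms returns the same list. -/
def Aperiodic {A : Type u} (l : List A) : Prop :=
  ∀ k, 0 < k → k < l.length → l.rotate k ≠ l

end

/-! ### Diagrams -/

/-- The composite of a path in a diagram. -/
def pathComposite {J : Type u₁} [Quiver.{v₁} J] {A : Type u₂} [Category.{v₂} A] (X : J ⥤q A)
    {i j : J} (p : Quiver.Path i j) : X.obj i ⟶ X.obj j :=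
  composePath (X.mapPath p)

/-- A diagram commutes if any two parallel composites are equal. -/
def DiagramCommutes {J : Type u₁} [Quiver.{v₁} J] {A : Type u₂} [Category.{v₂} A]
    (X : J ⥤q A) : Prop :=
  ∀ ⦃i j : J⦄ (p q : Quiver.Path i j), pathComposite X p = pathComposite X q

section

variable {C : Type u₁} [Bicategory.{w₁, v₁} C] {T : Type u₂} [Category.{v₂} T]
  {D : Type u₃} [Bicategory.{w₃, v₃} D] {T' : Type u₄} [Category.{v₄} T']
  {S : Shadow C T} {S' : Shadow D T'} {J : Type u} [Quiver.{v} J]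

/-- `L` is a formal lift of the diagram `X` in the target shadow category of `Φ`: a diagram of
formal morphisms whose interpretation is `X`. A diagram is formal if it has a formal lift. -/
def IsFormalLift (Φ : StrongShadowFunctor S S') (X : J ⥤q T') (L : J ⥤q FormalShadow C) : Prop :=
  L ⋙q Φ.eval.toPrefunctor = X

/-- A formal lift is expected to commute if any two parallel composites have the same underlying
cyclic permutation. -/
def ExpectedToCommute {G : Type u₁} [Quiver.{v₁} G] (L : J ⥤q FormalShadow G) : Prop :=
  ∀ ⦃i j : J⦄ (p q : Quiver.Path i j), perm (pathComposite L p) = perm (pathComposite L q)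

end

end ShadowCoherence

namespace ShadowCoherence

/-! ### Words in the free bicategory -/

/-! A formal morphism is determined by the rotation it induces (`eq_of_perm_eq`). This equality
already holds in the free shadow category, before evaluation, so a formal diagram commutes as soon
as parallel composites of its lift have the same rotation.

In the source of the free strong shadow functor, parallel 2-cells agree by coherence for
bicategories, so only rotators carry information. Two successive rotators cut the same intermediate
word in two places; refining both cuts to a common splitting into three blocks, the hexagon fuses
the rotators into one (`Shadow.IsRotator.comp`). Here one needs that θ_{g,f} is inverse to θ_{f,g},
which follows from the hexagon with a unit. Hence every morphism is a single rotator between two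
2-cells, and up to coherence it depends only on where the word is cut. The rotation recovers the
cut, except that it cannot tell a cut at the start from a cut at the end. In both of these cases one
block is empty, and the unit axioms turn the rotator into a 2-cell, so nothing is lost
(`sourcePerm_injective`).

In the target, the unit and composition isomorphisms of F followed by s identify every object with
some H⟨⟨w⟩⟩. The axioms of pseudofunctors and strong shadow functors say that under these
identifications each generator becomes H of a source morphism (`ShadowTarget.exists_flattens`).
Equality in the target thus reduces to equality in the source.

For aperiodic lists, a formal morphism matches equal edges, so its rotation carries one fixed list
to another. Two rotations that do so differ by a period of the list, and an aperiodic list has only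
the trivial one (`perm_eq_of_aperiodic`). -/

theorem exists_path_comp_eq {V : Type u} [Quiver.{v} V] {a b b' c : V} (p : Quiver.Path a b)
    (q : Quiver.Path b c) (p' : Quiver.Path a b') (q' : Quiver.Path b' c)
    (h : p.comp q = p'.comp q') (hl : q'.length ≤ q.length) :
    ∃ r : Quiver.Path b b', p' = p.comp r ∧ q = r.comp q' := by
  induction q' with
  | nil => exact ⟨q, h.symm, rfl⟩
  | cons q' e ih =>
    -- Last edges are stripped from both tails together; the length bound ensures that `q'` runs out
    -- first, and what is left of `q` is the middle segment.
    cases q with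
    | nil => simp at hl
    | cons q e' =>
      simp only [Quiver.Path.comp_cons] at h
      obtain rfl := Quiver.Path.obj_eq_of_cons_eq_cons h
      obtain ⟨r, hr, hr'⟩ := ih q (eq_of_heq (Quiver.Path.heq_of_cons_eq_cons h))
        (by simpa using hl)
      obtain rfl := eq_of_heq (Quiver.Path.hom_heq_of_cons_eq_cons h)
      exact ⟨r, hr, by rw [hr', Quiver.Path.comp_cons]⟩

section

variable {G : Type u} [Quiver.{v} G]

/-- The path of edges of a 1-cell of the free bicategory. -/
def pathOf {a b : G} (f : FreeBicategory.Hom a b) : Quiver.Path a b :=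
  FreeBicategory.normalizeAux .nil f

theorem pathOf_comp {a b c : FreeBicategory G} (f : a ⟶ b) (g : b ⟶ c) :
    pathOf (f ≫ g) = (pathOf f).comp (pathOf g) :=
  FreeBicategory.normalizeAux_nil_comp f g

theorem length_normalizeAux {a b c : G} (p : Quiver.Path a b) (f : FreeBicategory.Hom b c) :
    (FreeBicategory.normalizeAux p f).length = p.length + len f := by
  induction f with
  | of => rfl
  | id => rfl
  | comp f g hf hg =>
    rw [FreeBicategory.normalizeAux, hg, hf, Nat.add_assoc]
    rfl

theorem length_pathOf {a b : G} (f : FreeBicategory.Hom a b) : (pathOf f).length = len f :=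
  (length_normalizeAux _ f).trans (Nat.zero_add _)

theorem pathOf_inclusionPathAux {a b : G} (p : Quiver.Path a b) :
    pathOf (FreeBicategory.inclusionPathAux p) = p := by
  induction p with
  | nil => rfl
  | cons p e ih => exact congrArg (Quiver.Path.cons · e) ih

theorem pathOf_eq {a b : FreeBicategory G} {f g : a ⟶ b} (η : f ⟶ g) : pathOf f = pathOf g :=
  FreeBicategory.normalizeAux_congr .nil η

/-- Each word is isomorphic to the canonical bracketing of its path, so the path determines the word
up to isomorphism. -/
theorem nonempty_iso_of_pathOf_eq {a b : FreeBicategory G} {f g : a ⟶ b}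
    (h : pathOf f = pathOf g) : Nonempty (f ≅ g) :=
  ⟨(FreeBicategory.normalizeUnitIso a b).app f ≪≫
    eqToIso (congrArg FreeBicategory.inclusionPathAux h) ≪≫
      ((FreeBicategory.normalizeUnitIso a b).app g).symm⟩

/-- Both composites are the same path, cut in two places. The cut with the shorter tail lies further
along, and `h` is the piece between the cuts. -/
theorem exists_factor {a b b' c : FreeBicategory G} {f : a ⟶ b} {g : b ⟶ c} {f' : a ⟶ b'}
    {g' : b' ⟶ c} (e : pathOf (f ≫ g) = pathOf (f' ≫ g')) (hl : len g' ≤ len g) :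
    ∃ h : b ⟶ b', Nonempty (f' ≅ f ≫ h) ∧ Nonempty (g ≅ h ≫ g') := by
  rw [pathOf_comp, pathOf_comp] at e
  obtain ⟨r, hr, hr'⟩ := exists_path_comp_eq _ _ _ _ e (((length_pathOf g').le.trans hl).trans (length_pathOf g).ge)
  have k : pathOf (FreeBicategory.inclusionPathAux r) = r := pathOf_inclusionPathAux r
  refine ⟨FreeBicategory.inclusionPathAux r, nonempty_iso_of_pathOf_eq ?_,
    nonempty_iso_of_pathOf_eq ?_⟩
  · rw [pathOf_comp, k, hr]
  · rw [pathOf_comp, k, hr']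

theorem nonempty_iso_of_len_eq {a b c : FreeBicategory G} {f f' : a ⟶ b} {g g' : b ⟶ c}
    (η : f ≫ g ⟶ f' ≫ g') (hl : len g = len g') : Nonempty (f ≅ f') ∧ Nonempty (g ≅ g') := by
  have e := pathOf_eq η
  rw [pathOf_comp, pathOf_comp] at e
  obtain ⟨h, h'⟩ := (Quiver.Path.comp_inj ((length_pathOf g).trans (hl.trans (length_pathOf g').symm))).1 e
  exact ⟨nonempty_iso_of_pathOf_eq h, nonempty_iso_of_pathOf_eq h'⟩

theorem eq_of_len_eq_zero {a b : FreeBicategory G} (f : a ⟶ b) (h : len f = 0) : a = b :=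
  Quiver.Path.eq_of_length_zero (V := G) (pathOf f) ((length_pathOf f).trans h)

theorem nonempty_iso_id {a : FreeBicategory G} (f : a ⟶ a) (h : len f = 0) :
    Nonempty (f ≅ 𝟙 a) :=
  nonempty_iso_of_pathOf_eq (Quiver.Path.eq_nil_of_length_zero (pathOf f)
    ((length_pathOf f).trans h))

end

/-! ### Rotators -/

section

variable {B : Type u₁} [Bicategory.{w₁, v₁} B] {T : Type u₂} [Category.{v₂} T] (S : Shadow B T)

/-- The hexagon with a unit as first argument: its left side becomes the two rotators after removing
the unit, and its right side is a rotator past the unit, hence a unitor. -/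
theorem Shadow.θ_hom_θ_hom {a b : B} (f : a ⟶ b) (g : b ⟶ a) :
    (S.θ f g).hom ≫ (S.θ g f).hom = 𝟙 _ := by
  have h₁ := S.θ_assoc (𝟙 a) f g
  have h₂ := S.θ_naturality_left (λ_ f).hom g
  have h₃ := S.θ_naturality_left (ρ_ g).hom f
  have h₄ := S.θ_unit_left (f ≫ g)
  have h₅ : g ◁ (λ_ f).hom = (α_ g (𝟙 a) f).inv ≫ (ρ_ g).hom ▷ f := by simp
  have h₆ : (α_ f g (𝟙 a)).hom ≫ f ◁ (ρ_ g).hom = (ρ_ (f ≫ g)).hom := by simp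
  have h₇ : (λ_ f).hom ▷ g = (α_ (𝟙 a) f g).hom ≫ (λ_ (f ≫ g)).hom := by simp
  rw [← cancel_epi ((S.sh a).map ((λ_ f).hom ▷ g)), reassoc_of% h₂, h₅, Functor.map_comp,
    Category.assoc, h₃]
  rw [reassoc_of% h₁, ← Functor.map_comp, h₆, h₄, ← Functor.map_comp, ← h₇, Category.comp_id]

theorem Shadow.θ_inv_eq {a b : B} (f : a ⟶ b) (g : b ⟶ a) :
    (S.θ f g).inv = (S.θ g f).hom := by
  rw [← cancel_epi (S.θ f g).hom, Iso.hom_inv_id, S.θ_hom_θ_hom]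

/-- A morphism is a rotator up to 2-cells if it is a composite of a rotator with 2-cells. -/
def Shadow.IsRotator {a b : B} {w : a ⟶ a} {w' : b ⟶ b}
    (φ : (S.sh a).obj w ⟶ (S.sh b).obj w') : Prop :=
  ∃ (f : a ⟶ b) (g : b ⟶ a) (η : w ⟶ f ≫ g) (η' : g ≫ f ⟶ w'),
    φ = (S.sh a).map η ≫ (S.θ f g).hom ≫ (S.sh b).map η'

variable {S}

/-- By the unit axiom the rotator past `𝟙 a` is made of unitors, so a 2-cell counts as a rotator
with an empty second block. -/
theorem Shadow.isRotator_map {a : B} {w w' : a ⟶ a} (η : w ⟶ w') :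
    S.IsRotator ((S.sh a).map η) := by
  refine ⟨w, 𝟙 a, (ρ_ w).inv, (λ_ w).hom ≫ η, ?_⟩
  rw [Functor.map_comp, reassoc_of% (S.θ_unit_right w), ← Functor.map_comp, ← Functor.map_comp,
    Iso.inv_hom_id_assoc]

theorem Shadow.isRotator_θ {a b : B} (f : a ⟶ b) (g : b ⟶ a) : S.IsRotator (S.θ f g).hom :=
  ⟨f, g, 𝟙 _, 𝟙 _, by simp⟩

end

/-! ### Composition of rotators over a free bicategory -/

section

variable {G : Type u} [Quiver.{v} G] {T : Type u₂} [Category.{v₂} T]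
  {S : Shadow (FreeBicategory G) T}

/-- The middle word is split as `g ≫ f` by the first rotator and as `f' ≫ g'` by the second.
Whichever cut comes first, the two together give three blocks, and the hexagon merges the rotators.
-/
theorem Shadow.IsRotator.comp {a b c : FreeBicategory G} {w : a ⟶ a} {w' : b ⟶ b} {w'' : c ⟶ c}
    {φ : (S.sh a).obj w ⟶ (S.sh b).obj w'} {ψ : (S.sh b).obj w' ⟶ (S.sh c).obj w''}
    (hφ : S.IsRotator φ) (hψ : S.IsRotator ψ) : S.IsRotator (φ ≫ ψ) := by
  obtain ⟨f, g, η, η', rfl⟩ := hφ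
  obtain ⟨f', g', ζ, ζ', rfl⟩ := hψ
  rcases le_total (len g') (len f) with hl | hl
  · obtain ⟨h, ⟨s⟩, ⟨t⟩⟩ := exists_factor (pathOf_eq (η' ≫ ζ)) hl
    refine ⟨h, g' ≫ g, η ≫ t.hom ▷ g ≫ (α_ _ _ _).hom,
      (α_ _ _ _).hom ≫ g' ◁ s.inv ≫ ζ', ?_⟩
    -- Parallel 2-cells of a free bicategory are equal, so the middle 2-cell may be replaced by one
    -- adapted to the three blocks.
    have e : η' ≫ ζ = g ◁ t.hom ≫ (α_ g h g').inv ≫ s.inv ▷ g' := Subsingleton.elim _ _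
    have h₁ := S.θ_naturality_left t.hom g
    have h₂ := S.θ_naturality_left s.inv g'
    have h₃ := S.θ_assoc h g' g
    simp only [Category.assoc, Functor.map_comp]
    rw [← Functor.map_comp_assoc _ η' ζ, e, Functor.map_comp, Functor.map_comp]
    simp only [Category.assoc] at h₃ ⊢
    rw [reassoc_of% h₂, ← reassoc_of% h₁, reassoc_of% h₃]
  -- Now the blocks are `f'`, `h`, `f`, and the composite moves `f ≫ f'` past `h`.
  · obtain ⟨h, ⟨s⟩, ⟨t⟩⟩ := exists_factor (pathOf_eq (η' ≫ ζ)).symm hl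
    refine ⟨f ≫ f', h, η ≫ f ◁ s.hom ≫ (α_ _ _ _).inv, (α_ _ _ _).inv ≫ t.inv ▷ f' ≫ ζ', ?_⟩
    have e : η' ≫ ζ = s.hom ▷ f ≫ (α_ f' h f).hom ≫ f' ◁ t.inv := Subsingleton.elim _ _
    have h₁ := S.θ_naturality_right f s.hom
    have h₂ := S.θ_naturality_right f' t.inv
    have h₃ := S.θ_assoc f f' h
    -- The hexagon has the rotator of `h ≫ f` past `f'` on its other side; it is moved across as the
    -- opposite rotator, its inverse.
    have h₄ : (S.sh a).map (α_ f f' h).inv ≫ (S.θ (f ≫ f') h).hom ≫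
        (S.sh c).map (α_ h f f').inv =
          (S.θ f (f' ≫ h)).hom ≫ (S.sh b).map (α_ f' h f).hom ≫ (S.θ f' (h ≫ f)).hom := by
      rw [← cancel_epi ((S.sh a).map (α_ f f' h).hom), ← reassoc_of% h₃, S.θ_hom_θ_hom,
        ← Functor.map_comp_assoc, Iso.hom_inv_id]
      simp
    simp only [Category.assoc, Functor.map_comp]
    rw [← Functor.map_comp_assoc _ η' ζ, e, Functor.map_comp, Functor.map_comp]
    simp only [Category.assoc]
    rw [reassoc_of% h₂, ← reassoc_of% h₁, reassoc_of% h₄]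

end

/-! ### Morphisms of the free shadow category and their rotations -/

section

variable {G : Type u} [Quiver.{v} G]

theorem isRotator_freeSource {x y : FreeShadow (FreeBicategory G)} (φ : x ⟶ y) :
    (freeSource G).IsRotator (w := x.word) (w' := y.word) φ := by
  suffices h : ∀ {x y : FreeShadow (FreeBicategory G)} (p : FreeShadow.Term x y),
      (freeSource G).IsRotator (w := x.word) (w' := y.word) (FreeShadow.liftTerm (freeSource G) p)
      by
    -- Interpreting a term in the universal shadow returns its own class, so the claim may be proved
    -- by induction on interpreted terms.
    have k : ∀ {x y : FreeShadow (FreeBicategory G)} (p : FreeShadow.Term x y),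
        FreeShadow.liftTerm (freeSource G) p = Quot.mk _ p := by
      intro x y p
      induction p with
      | comp p q hp hq =>
        rw [FreeShadow.liftTerm, hp, hq]
        rfl
      | _ => rfl
    obtain ⟨p⟩ := φ
    have h' := h p
    rwa [k] at h'
  clear φ
  intro x y p
  induction p with
  | id x =>
    have h := Shadow.isRotator_map (S := freeSource G) (𝟙 x.word)
    rwa [CategoryTheory.Functor.map_id] at h
  | comp p q hp hq => exact Shadow.IsRotator.comp hp hq
  | sh η => exact Shadow.isRotator_map η
  | rot f g => exact Shadow.isRotator_θ f g
  | rot_inv f g =>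
    have h := Shadow.isRotator_θ (S := freeSource G) g f
    rwa [← Shadow.θ_inv_eq] at h

/-- A rotator one of whose arguments has no edges is a 2-cell. -/
theorem rotator_eq_map {T : Type u₂} [Category.{v₂} T] (S : Shadow (FreeBicategory G) T)
    {a : FreeBicategory G} (f g : a ⟶ a) (h : len f = 0 ∨ len g = 0) :
    ∃ η : f ≫ g ⟶ g ≫ f, (S.θ f g).hom = (S.sh a).map η := by
  rcases h with h | h
  · obtain ⟨e⟩ := nonempty_iso_id f h
    -- Replace the empty word by a unit along `e`; the unit axiom, solved for the rotator, gives the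
    -- two unitors in the middle.
    refine ⟨e.hom ▷ g ≫ (λ_ g).hom ≫ (ρ_ g).inv ≫ g ◁ e.inv, ?_⟩
    have h₁ := S.θ_naturality_left e.hom g
    have h₂ := S.θ_unit_left g
    have h₃ : (S.θ (𝟙 a) g).hom = (S.sh a).map ((λ_ g).hom ≫ (ρ_ g).inv) := by
      rw [Functor.map_comp, ← h₂, Category.assoc, ← Functor.map_comp, Iso.hom_inv_id]
      simp
    rw [Functor.map_comp, ← Category.assoc (λ_ g).hom, Functor.map_comp, ← h₃, reassoc_of% h₁,
      ← Functor.map_comp, ← Bicategory.whiskerLeft_comp, Iso.hom_inv_id]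
    simp
  · obtain ⟨e⟩ := nonempty_iso_id g h
    refine ⟨f ◁ e.hom ≫ (ρ_ f).hom ≫ (λ_ f).inv ≫ e.inv ▷ f, ?_⟩
    have h₁ := S.θ_naturality_right f e.hom
    have h₂ := S.θ_unit_right f
    have h₃ : (S.θ f (𝟙 a)).hom = (S.sh a).map ((ρ_ f).hom ≫ (λ_ f).inv) := by
      rw [Functor.map_comp, ← h₂, Category.assoc, ← Functor.map_comp, Iso.hom_inv_id]
      simp
    rw [Functor.map_comp, ← Category.assoc (ρ_ f).hom, Functor.map_comp, ← h₃, reassoc_of% h₁,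
      ← Functor.map_comp, ← Bicategory.comp_whiskerRight, Iso.hom_inv_id]
    simp

/-- Both sides are shadows of 2-cells, and parallel 2-cells agree. The two cuts may lie at opposite
ends of the word, which is the ambiguity that the rotation does not see. -/
theorem rotator_eq_map' {T : Type u₂} [Category.{v₂} T] (S : Shadow (FreeBicategory G) T)
    {a b : FreeBicategory G} {f : a ⟶ b} {g : b ⟶ a} {w : a ⟶ a} {w' : b ⟶ b}
    (η : w ⟶ f ≫ g) (η' : g ≫ f ⟶ w') {f₀ : a ⟶ b} {g₀ : b ⟶ a}
    (ζ : w ⟶ f₀ ≫ g₀) (ζ' : g₀ ≫ f₀ ⟶ w')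
    (h : len f = 0 ∨ len g = 0) (h' : len f₀ = 0 ∨ len g₀ = 0) :
    (S.sh a).map η ≫ (S.θ f g).hom ≫ (S.sh b).map η' =
      (S.sh a).map ζ ≫ (S.θ f₀ g₀).hom ≫ (S.sh b).map ζ' := by
  obtain rfl : a = b := by
    rcases h with h | h
    exacts [eq_of_len_eq_zero f h, (eq_of_len_eq_zero g h).symm]
  obtain ⟨t, ht⟩ := rotator_eq_map S f g h
  obtain ⟨t', ht'⟩ := rotator_eq_map S f₀ g₀ h'
  rw [ht, ht', ← Functor.map_comp, ← Functor.map_comp, ← Functor.map_comp, ← Functor.map_comp]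
  exact congrArg _ (Subsingleton.elim _ _)

/-- Equal tail lengths mean that `w` is cut at the same place, so the blocks are isomorphic in
pairs. Naturality of the rotator carries one composite to the other, and coherence matches the outer
2-cells. -/
theorem rotator_eq_of_len_eq {T : Type u₂} [Category.{v₂} T] (S : Shadow (FreeBicategory G) T)
    {a b : FreeBicategory G} {f : a ⟶ b} {g : b ⟶ a} {w : a ⟶ a} {w' : b ⟶ b}
    (η : w ⟶ f ≫ g) (η' : g ≫ f ⟶ w') {f₀ : a ⟶ b} {g₀ : b ⟶ a}
    (ζ : w ⟶ f₀ ≫ g₀) (ζ' : g₀ ≫ f₀ ⟶ w') (h : len g = len g₀) :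
    (S.sh a).map η ≫ (S.θ f g).hom ≫ (S.sh b).map η' =
      (S.sh a).map ζ ≫ (S.θ f₀ g₀).hom ≫ (S.sh b).map ζ' := by
  obtain ⟨⟨s⟩, ⟨t⟩⟩ : Nonempty (f ≅ f₀) ∧ Nonempty (g ≅ g₀) := by
    have e := (pathOf_eq η).symm.trans (pathOf_eq ζ)
    obtain ⟨i⟩ := nonempty_iso_of_pathOf_eq e
    exact nonempty_iso_of_len_eq i.hom h
  have h₁ := S.θ_naturality_left s.hom g
  have h₂ := S.θ_naturality_right f₀ t.hom
  have e₁ : ζ = η ≫ s.hom ▷ g ≫ f₀ ◁ t.hom := Subsingleton.elim _ _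
  have e₂ : η' = g ◁ s.hom ≫ t.hom ▷ f₀ ≫ ζ' := Subsingleton.elim _ _
  rw [e₁, e₂]
  simp only [Functor.map_comp, Category.assoc]
  rw [reassoc_of% h₂, reassoc_of% h₁]

/-- Writing both morphisms as single rotators, it suffices to read off the cut from the rotation. -/
theorem sourcePerm_injective {x y : FreeShadow (FreeBicategory G)} {φ ψ : x ⟶ y}
    (h : sourcePerm φ = sourcePerm ψ) : φ = ψ := by
  obtain ⟨f, g, η, η', rfl⟩ := isRotator_freeSource φ
  obtain ⟨f₀, g₀, ζ, ζ', rfl⟩ := isRotator_freeSource ψ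
  obtain ⟨η⟩ := η
  obtain ⟨η'⟩ := η'
  obtain ⟨ζ⟩ := ζ
  obtain ⟨ζ'⟩ := ζ'
  have hx : len x.word = len f + len g := hom₂_len_eq η
  have hx₀ : len x.word = len f₀ + len g₀ := hom₂_len_eq ζ
  have hy : len y.word = len g + len f := (hom₂_len_eq η').symm
  have hy₀ : len y.word = len g₀ + len f₀ := (hom₂_len_eq ζ').symm
  replace h : (finCongr hx).trans ((blockRotation (len f) (len g)).trans (finCongr hy.symm)) =
    (finCongr hx₀).trans ((blockRotation (len f₀) (len g₀)).trans (finCongr hy₀.symm)) := h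
  have key : len g = len g₀ ∨
      ((len f = 0 ∨ len g = 0) ∧ (len f₀ = 0 ∨ len g₀ = 0)) := by
    rcases Nat.eq_zero_or_pos (len x.word) with h0 | h0
    · omega
    -- The first position goes to `len g` when `f` is nonempty and stays at `0` otherwise, so its
    -- image fixes the cut unless both morphisms have an empty block.
    · have k := congrArg Fin.val (DFunLike.congr_fun h ⟨0, h0⟩)
      simp only [Equiv.trans_apply, finCongr_apply, Fin.val_cast, blockRotation_val] at k
      split_ifs at k <;> omega
  rcases key with k | ⟨k, k'⟩
  · exact rotator_eq_of_len_eq _ _ _ _ _ k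
  · exact rotator_eq_map' _ _ _ _ _ k k'

end

/-! ### Reduction of the target of a free strong shadow functor to its source -/

section

variable {B : Type u₁} [Bicategory.{w₁, v₁} B] {D : Type u₃} [Bicategory.{w₃, v₃} D]
  {K : B ⥤ᵖ D}

/-- The composite of isomorphisms `f ≅ K w` and `g ≅ K w'`. -/
def compMapIso {a b c : B} {f : K.obj a ⟶ K.obj b} {g : K.obj b ⟶ K.obj c} {w : a ⟶ b}
    {w' : b ⟶ c} (e : f ≅ K.map w) (e' : g ≅ K.map w') : f ≫ g ≅ K.map (w ≫ w') :=
  whiskerRightIso e g ≪≫ whiskerLeftIso (K.map w) e' ≪≫ (K.mapComp w w').symm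

theorem compMapIso_hom {a b c : B} {f : K.obj a ⟶ K.obj b} {g : K.obj b ⟶ K.obj c} {w : a ⟶ b}
    {w' : b ⟶ c} (e : f ≅ K.map w) (e' : g ≅ K.map w') :
    (compMapIso e e').hom = e.hom ▷ g ≫ K.map w ◁ e'.hom ≫ (K.mapComp w w').inv :=
  rfl

/-- A 2-cell `η` corresponds to `K η'` under isomorphisms of its source and target with 1-cells in
the image of `K`. -/
def FlattensTo {a b : B} {f g : K.obj a ⟶ K.obj b} {w x : a ⟶ b} (e : f ≅ K.map w)
    (e' : g ≅ K.map x) (η : f ⟶ g) (η' : w ⟶ x) : Prop :=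
  η ≫ e'.hom = e.hom ≫ K.map₂ η'

namespace FlattensTo

theorem id {a b : B} {f : K.obj a ⟶ K.obj b} {w : a ⟶ b} (e : f ≅ K.map w) :
    FlattensTo e e (𝟙 f) (𝟙 w) := by
  unfold FlattensTo
  simp

theorem comp {a b : B} {f g h : K.obj a ⟶ K.obj b} {w x y : a ⟶ b} {e : f ≅ K.map w}
    {e' : g ≅ K.map x} {e'' : h ≅ K.map y} {η : f ⟶ g} {θ : g ⟶ h} {η' : w ⟶ x} {θ' : x ⟶ y}
    (k : FlattensTo e e' η η') (k' : FlattensTo e' e'' θ θ') :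
    FlattensTo e e'' (η ≫ θ) (η' ≫ θ') := by
  unfold FlattensTo at *
  rw [Category.assoc, k', reassoc_of% k, K.map₂_comp]

theorem inv {a b : B} {f g : K.obj a ⟶ K.obj b} {w x : a ⟶ b} {e : f ≅ K.map w}
    {e' : g ≅ K.map x} {η : f ≅ g} {η' : w ≅ x} (k : FlattensTo e e' η.hom η'.hom) :
    FlattensTo e' e η.inv η'.inv := by
  unfold FlattensTo at *
  rw [Iso.inv_comp_eq, reassoc_of% k, ← K.map₂_comp, Iso.hom_inv_id, K.map₂_id, Category.comp_id]

theorem whiskerLeft {a b c : B} {f : K.obj a ⟶ K.obj b} {w : a ⟶ b} (d : f ≅ K.map w)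
    {g h : K.obj b ⟶ K.obj c} {x y : b ⟶ c} {e : g ≅ K.map x} {e' : h ≅ K.map y} {η : g ⟶ h}
    {η' : x ⟶ y} (k : FlattensTo e e' η η') :
    FlattensTo (compMapIso d e) (compMapIso d e') (f ◁ η) (w ◁ η') := by
  unfold FlattensTo at *
  have n := PseudoTarget.map_mul_naturality_right K w η'
  rw [compMapIso_hom, compMapIso_hom, Category.assoc, Category.assoc, n,
    ← Bicategory.whiskerLeft_comp_assoc, ← k, Bicategory.whiskerLeft_comp_assoc,
    whisker_exchange_assoc]

theorem whiskerRight {a b c : B} {f g : K.obj a ⟶ K.obj b} {w x : a ⟶ b} {e : f ≅ K.map w}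
    {e' : g ≅ K.map x} {h : K.obj b ⟶ K.obj c} {y : b ⟶ c} (d : h ≅ K.map y) {η : f ⟶ g}
    {η' : w ⟶ x} (k : FlattensTo e e' η η') :
    FlattensTo (compMapIso e d) (compMapIso e' d) (η ▷ h) (η' ▷ y) := by
  unfold FlattensTo at *
  have n := PseudoTarget.map_mul_naturality_left K η' y
  rw [compMapIso_hom, compMapIso_hom, Category.assoc, Category.assoc, n,
    whisker_exchange_assoc, ← comp_whiskerRight_assoc, ← comp_whiskerRight_assoc, ← k]

theorem associator {a b c d : B} {f : K.obj a ⟶ K.obj b} {g : K.obj b ⟶ K.obj c}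
    {h : K.obj c ⟶ K.obj d} {w : a ⟶ b} {x : b ⟶ c} {y : c ⟶ d} (e : f ≅ K.map w)
    (e' : g ≅ K.map x) (e'' : h ≅ K.map y) :
    FlattensTo (compMapIso (compMapIso e e') e'') (compMapIso e (compMapIso e' e''))
      (α_ f g h).hom (α_ w x y).hom := by
  have k := PseudoTarget.map_mul_assoc K w x y
  unfold FlattensTo
  -- By interchange, `e`, `e'`, `e''` are applied first and the composition maps of `K` last, so
  -- that the associativity axiom of `K` applies to the tail.
  have e₁ : (compMapIso (compMapIso e e') e'').hom =
      (e.hom ▷ g ≫ K.map w ◁ e'.hom) ▷ h ≫ (K.map w ≫ K.map x) ◁ e''.hom ≫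
        (K.mapComp w x).inv ▷ K.map y ≫ (K.mapComp (w ≫ x) y).inv := by
    rw [whisker_exchange_assoc, ← comp_whiskerRight_assoc, Category.assoc]
    rfl
  have e₂ : (compMapIso e (compMapIso e' e'')).hom =
      e.hom ▷ (g ≫ h) ≫ K.map w ◁ (e'.hom ▷ h ≫ K.map x ◁ e''.hom) ≫
        K.map w ◁ (K.mapComp x y).inv ≫ (K.mapComp w (x ≫ y)).inv := by
    rw [← Bicategory.whiskerLeft_comp_assoc, Category.assoc]
    rfl
  rw [e₁, e₂]
  simp only [Category.assoc]
  rw [k]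
  simp

theorem leftUnitor {a b : B} {f : K.obj a ⟶ K.obj b} {w : a ⟶ b} (e : f ≅ K.map w) :
    FlattensTo (compMapIso (K.mapId a).symm e) e (λ_ f).hom (λ_ w).hom := by
  have k := PseudoTarget.map_unit_mul K w
  unfold FlattensTo
  rw [compMapIso_hom, Iso.symm_hom, ← whisker_exchange_assoc]
  simp only [Category.assoc]
  rw [k]
  simp

theorem rightUnitor {a b : B} {f : K.obj a ⟶ K.obj b} {w : a ⟶ b} (e : f ≅ K.map w) :
    FlattensTo (compMapIso e (K.mapId b).symm) e (ρ_ f).hom (ρ_ w).hom := by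
  have k := PseudoTarget.map_mul_unit K w
  unfold FlattensTo
  rw [compMapIso_hom, Iso.symm_hom]
  simp only [Category.assoc]
  rw [k]
  simp

theorem map₂ {a b : B} {w x : a ⟶ b} (η : w ⟶ x) :
    FlattensTo (Iso.refl (K.map w)) (Iso.refl (K.map x)) (K.map₂ η) η := by
  unfold FlattensTo
  simp

/-- The flattening isomorphisms are built from the unit and composition maps, so these two
generators flatten to identities. Both are phrased through `Iso.hom` so that `inv` covers their
inverses. -/
theorem unit (a : B) :
    FlattensTo (K.mapId a).symm (Iso.refl (K.map (𝟙 a))) (K.mapId a).symm.hom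
      (Iso.refl (𝟙 a)).hom := by
  unfold FlattensTo
  simp

theorem mul {a b c : B} (w : a ⟶ b) (x : b ⟶ c) :
    FlattensTo (compMapIso (Iso.refl (K.map w)) (Iso.refl (K.map x))) (Iso.refl (K.map (w ≫ x)))
      (K.mapComp w x).symm.hom (Iso.refl (w ≫ x)).hom := by
  unfold FlattensTo
  simp [compMapIso_hom]

end FlattensTo

end

/-! ### Flattening words to single letters -/

namespace PseudoTarget

variable {B : Type u₁} [Bicategory.{w₁, v₁} B]

/-- A word, as a 1-cell of `PseudoTarget B`. -/
def ofHom {a b : B} (f : Hom a b) : (incl B).obj a ⟶ (incl B).obj b := f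

/-- The composite in `B` of the letters of a word. -/
def flat : ∀ {a b : B}, Hom a b → (a ⟶ b)
  | _, _, .app w => w
  | _, _, .id a => 𝟙 a
  | _, _, .comp f g => flat f ≫ flat g

/-- The isomorphism of a word with a single letter. -/
def flatIso : ∀ {a b : B} (f : Hom a b), ofHom f ≅ (incl B).map (flat f)
  | _, _, .app w => Iso.refl ((incl B).map w)
  | _, _, .id a => ((incl B).mapId a).symm
  | _, _, .comp f g => compMapIso (flatIso f) (flatIso g)

/-- Each generator flattens by the pseudofunctor axiom that governs it. Only existence of the 2-cell
is needed, so no choice has to be checked against the relations. -/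
theorem exists_flattensTo_mk {a b : B} {f g : Hom a b} (η : Hom₂ f g) :
    ∃ η' : flat f ⟶ flat g, FlattensTo (flatIso f) (flatIso g) (Quot.mk _ η) η' := by
  induction η with
  | id f => exact ⟨_, FlattensTo.id (flatIso f)⟩
  | vcomp _ _ h h' =>
    obtain ⟨_, h⟩ := h
    obtain ⟨_, h'⟩ := h'
    exact ⟨_, h.comp h'⟩
  | whisker_left f _ h =>
    obtain ⟨_, h⟩ := h
    exact ⟨_, h.whiskerLeft (flatIso f)⟩
  | whisker_right k _ h =>
    obtain ⟨_, h⟩ := h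
    exact ⟨_, h.whiskerRight (flatIso k)⟩
  | associator f g h => exact ⟨_, .associator (flatIso f) (flatIso g) (flatIso h)⟩
  | associator_inv f g h => exact ⟨_, (FlattensTo.associator (flatIso f) (flatIso g) (flatIso h)).inv⟩
  | right_unitor f => exact ⟨_, .rightUnitor (flatIso f)⟩
  | right_unitor_inv f => exact ⟨_, (FlattensTo.rightUnitor (flatIso f)).inv⟩
  | left_unitor f => exact ⟨_, .leftUnitor (flatIso f)⟩
  | left_unitor_inv f => exact ⟨_, (FlattensTo.leftUnitor (flatIso f)).inv⟩
  | app η => exact ⟨_, .map₂ (K := incl B) η⟩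
  | unit a => exact ⟨_, .unit (K := incl B) a⟩
  | unit_inv a => exact ⟨_, (FlattensTo.unit (K := incl B) a).inv⟩
  | mul w w' => exact ⟨_, .mul (K := incl B) w w'⟩
  | mul_inv w w' => exact ⟨_, (FlattensTo.mul (K := incl B) w w').inv⟩

theorem exists_flattensTo {a b : B} {f g : Hom a b} (η : ofHom f ⟶ ofHom g) :
    ∃ η' : flat f ⟶ flat g, FlattensTo (flatIso f) (flatIso g) η η' := by
  obtain ⟨η⟩ := η
  exact exists_flattensTo_mk η

end PseudoTarget

/-! ### Shadow commutators and flattening -/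

section

variable {B : Type u₁} [Bicategory.{w₁, v₁} B] {T : Type u₂} [Category.{v₂} T] {S : Shadow B T}
  {D : Type u₃} [Bicategory.{w₃, v₃} D] {T' : Type u₄} [Category.{v₄} T'] {S' : Shadow D T'}
  (Φ : StrongShadowFunctor S S')

/-- The isomorphism `⟨⟨f⟩⟩ ≅ H⟨⟨w⟩⟩` induced by an isomorphism `f ≅ F(w)`. -/
def StrongShadowFunctor.sIso {a : B} {f : Φ.F.obj a ⟶ Φ.F.obj a} {w : a ⟶ a}
    (e : f ≅ Φ.F.map w) : (S'.sh (Φ.F.obj a)).obj f ≅ Φ.H.obj ((S.sh a).obj w) :=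
  (S'.sh (Φ.F.obj a)).mapIso e ≪≫ Φ.s w

theorem StrongShadowFunctor.map_comp_sIso {a : B} {f g : Φ.F.obj a ⟶ Φ.F.obj a} {w x : a ⟶ a}
    {e : f ≅ Φ.F.map w} {e' : g ≅ Φ.F.map x} {η : f ⟶ g} {η' : w ⟶ x}
    (h : FlattensTo e e' η η') :
    (S'.sh (Φ.F.obj a)).map η ≫ (Φ.sIso e').hom =
      (Φ.sIso e).hom ≫ Φ.H.map ((S.sh a).map η') := by
  have k := congrArg (S'.sh (Φ.F.obj a)).map h
  have n := Φ.s_naturality η'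
  simp only [Functor.map_comp] at k
  simp only [sIso, Iso.trans_hom, Functor.mapIso_hom, Category.assoc]
  rw [reassoc_of% k, n]

/-- Naturality of the rotator in both arguments reduces to the case of two letters, which is the
axiom relating `s` and `θ`. -/
theorem StrongShadowFunctor.θ_comp_sIso {a b : B} {f : Φ.F.obj a ⟶ Φ.F.obj b}
    {g : Φ.F.obj b ⟶ Φ.F.obj a} {w : a ⟶ b} {x : b ⟶ a} (e : f ≅ Φ.F.map w)
    (e' : g ≅ Φ.F.map x) :
    (S'.θ f g).hom ≫ (Φ.sIso (compMapIso e' e)).hom =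
      (Φ.sIso (compMapIso e e')).hom ≫ Φ.H.map (S.θ w x).hom := by
  have n₁ := S'.θ_naturality_left e.hom g
  have n₂ := S'.θ_naturality_right (Φ.F.map w) e'.hom
  have k := Φ.s_θ w x
  -- Interchange reorders the two factors to match the order in which naturality produces them.
  have h : (compMapIso e' e).hom =
      g ◁ e.hom ≫ e'.hom ▷ Φ.F.map w ≫ (Φ.F.mapComp x w).inv := by
    rw [whisker_exchange_assoc]
    rfl
  simp only [sIso, Iso.trans_hom, Functor.mapIso_hom, h]
  simp only [compMapIso_hom, Functor.map_comp, Category.assoc]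
  rw [← k, reassoc_of% n₂, reassoc_of% n₁]

end

/-! ### Flattening formal morphisms into the image of `H` -/

namespace ShadowTarget

variable {B : Type u₁} [Bicategory.{w₁, v₁} B] {T : Type u₂} [Category.{v₂} T] {S : Shadow B T}

/-- The shadow in `T` of the composite of the letters of a word. -/
def flatWord (S : Shadow B T) {a : B} (f : PseudoTarget.Hom a a) : T :=
  (S.sh a).obj (PseudoTarget.flat f)

/-- The isomorphism `⟨⟨f⟩⟩ ≅ H⟨⟨w⟩⟩`, with `w` the composite of the letters of `f`. -/
def flatWordIso (S : Shadow B T) {a : B} (f : PseudoTarget.Hom a a) :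
    ((shadow (PseudoTarget.incl B) S).sh ((PseudoTarget.incl B).obj a)).obj (PseudoTarget.ofHom f) ≅
      (incl (PseudoTarget.incl B) S).H.obj (flatWord S f) :=
  (incl (PseudoTarget.incl B) S).sIso (PseudoTarget.flatIso f)

/-- The underlying object of `T` of an object of the shadow category. -/
def flat : ShadowTarget (PseudoTarget.incl B) S → T
  | .app x => x
  | .sh (a := a) f => flatWord S (a := a) f

/-- The isomorphism of an object with one in the image of `H`. -/
def flatIso : ∀ x : ShadowTarget (PseudoTarget.incl B) S,
    x ≅ (incl (PseudoTarget.incl B) S).H.obj (flat x)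
  | .app x => Iso.refl ((incl (PseudoTarget.incl B) S).H.obj x)
  | .sh (a := a) f => flatWordIso S (a := a) f

/-- A morphism `φ` corresponds to `H ψ`. -/
def Flattens {x y : ShadowTarget (PseudoTarget.incl B) S} (φ : x ⟶ y) (ψ : flat x ⟶ flat y) :
    Prop :=
  φ ≫ (flatIso y).hom = (flatIso x).hom ≫ (incl (PseudoTarget.incl B) S).H.map ψ

theorem Flattens.inv {x y : ShadowTarget (PseudoTarget.incl B) S} (e : x ≅ y)
    (ψ : flat x ≅ flat y) (h : Flattens e.hom ψ.hom) : Flattens e.inv ψ.inv := by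
  unfold Flattens at *
  rw [Iso.inv_comp_eq, reassoc_of% h, ← Functor.map_comp, Iso.hom_inv_id,
    CategoryTheory.Functor.map_id, Category.comp_id]

theorem Flattens.id (x : ShadowTarget (PseudoTarget.incl B) S) : Flattens (𝟙 x) (𝟙 (flat x)) := by
  unfold Flattens
  rw [CategoryTheory.Functor.map_id, Category.comp_id, Category.id_comp]

theorem Flattens.comp {x y z : ShadowTarget (PseudoTarget.incl B) S} {φ : x ⟶ y} {φ' : y ⟶ z}
    {ψ : flat x ⟶ flat y} {ψ' : flat y ⟶ flat z} (h : Flattens φ ψ) (h' : Flattens φ' ψ') :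
    Flattens (φ ≫ φ') (ψ ≫ ψ') := by
  unfold Flattens at *
  rw [Functor.map_comp, ← reassoc_of% h, ← h', Category.assoc]

theorem Flattens.app {x y : T} (φ : x ⟶ y) :
    Flattens ((incl (PseudoTarget.incl B) S).H.map φ) φ :=
  (Category.comp_id ((incl (PseudoTarget.incl B) S).H.map φ)).trans
    (Category.id_comp ((incl (PseudoTarget.incl B) S).H.map φ)).symm

/-- On a single letter the flattening isomorphism is the commutator itself, so `s` flattens to an
identity. -/
theorem Flattens.s {a : B} (f : a ⟶ a) :
    Flattens ((incl (PseudoTarget.incl B) S).s f).hom (Iso.refl ((S.sh a).obj f)).hom := by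
  have h : ((incl (PseudoTarget.incl B) S).sIso (Iso.refl _)).hom =
      ((incl (PseudoTarget.incl B) S).s f).hom := by
    simp [StrongShadowFunctor.sIso]
  refine (Category.comp_id _).trans (h.symm.trans ?_)
  have k := (incl (PseudoTarget.incl B) S).H.map_id ((S.sh a).obj f)
  exact (Category.comp_id _).symm.trans (congrArg _ k.symm)

/-- This is fullness of `H` up to `flatIso`, generator by generator; the rotator case is the
compatibility of `s` with `θ`. -/
theorem exists_flattens_mk {x y : ShadowTarget (PseudoTarget.incl B) S} (p : Term x y) :
    ∃ ψ : flat x ⟶ flat y, Flattens (Quot.mk _ p) ψ := by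
  induction p with
  | id x => exact ⟨_, .id x⟩
  | comp p q hp hq =>
    obtain ⟨ψ, hp⟩ := hp
    obtain ⟨ψ', hq⟩ := hq
    exact ⟨_, hp.comp hq⟩
  | app φ => exact ⟨φ, .app φ⟩
  | sh η =>
    obtain ⟨η', h⟩ := PseudoTarget.exists_flattensTo η
    exact ⟨_, (incl (PseudoTarget.incl B) S).map_comp_sIso h⟩
  | rot f g =>
    exact ⟨(S.θ (PseudoTarget.flat f) (PseudoTarget.flat g)).hom,
      (incl (PseudoTarget.incl B) S).θ_comp_sIso (PseudoTarget.flatIso f)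
      (PseudoTarget.flatIso g)⟩
  | rot_inv f g =>
    exact ⟨(S.θ (PseudoTarget.flat f) (PseudoTarget.flat g)).inv,
      Flattens.inv ((shadow (PseudoTarget.incl B) S).θ f g)
        (S.θ (PseudoTarget.flat f) (PseudoTarget.flat g))
      ((incl (PseudoTarget.incl B) S).θ_comp_sIso (PseudoTarget.flatIso f)
        (PseudoTarget.flatIso g))⟩
  | s f => exact ⟨_, .s f⟩
  | s_inv f => exact ⟨(Iso.refl ((S.sh _).obj f)).inv,
      Flattens.inv ((incl (PseudoTarget.incl B) S).s f) (Iso.refl _) (.s f)⟩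

theorem exists_flattens {x y : ShadowTarget (PseudoTarget.incl B) S} (φ : x ⟶ y) :
    ∃ ψ : flat x ⟶ flat y, Flattens φ ψ := by
  obtain ⟨p⟩ := φ
  exact exists_flattens_mk p

end ShadowTarget

/-! ### Formal morphisms are determined by their rotation -/

section

variable {G : Type u} [Quiver.{v} G]

theorem perm_comp {x y z : FormalShadow G} (φ : x ⟶ y) (ψ : y ⟶ z) :
    perm (φ ≫ ψ) = (perm φ).trans (perm ψ) := by
  obtain ⟨p⟩ := φ
  obtain ⟨q⟩ := ψ
  rfl

theorem equiv_trans_left_cancel {α : Type u₁} {β : Type u₂} {γ : Type u₃} (e : α ≃ β)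
    {f g : β ≃ γ} (h : e.trans f = e.trans g) : f = g :=
  Equiv.ext fun i => by simpa using DFunLike.congr_fun h (e.symm i)

/-- Conjugation by `flatIso` moves both morphisms into the image of `H`, where the rotation
determines the source morphism. -/
theorem eq_of_perm_eq {x y : FormalShadow G} {φ ψ : x ⟶ y} (h : perm φ = perm ψ) : φ = ψ := by
  obtain ⟨φ', hφ⟩ := ShadowTarget.exists_flattens φ
  obtain ⟨ψ', hψ⟩ := ShadowTarget.exists_flattens ψ
  have e : φ' = ψ' := by
    apply sourcePerm_injective
    -- The rotation of `H.map φ'` is that of `φ'` by definition. The bijection coming from `flatIso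
    -- x` is common to both sides and cancels, so its value is irrelevant.
    have k : perm ((ShadowTarget.flatIso x).hom ≫
        (freeStrongShadowFunctor G).H.map φ') = perm ((ShadowTarget.flatIso x).hom ≫
        (freeStrongShadowFunctor G).H.map ψ') := by
      rw [← hφ, ← hψ, perm_comp, perm_comp, h]
    rw [perm_comp, perm_comp] at k
    exact equiv_trans_left_cancel _ k
  rw [← cancel_mono (ShadowTarget.flatIso y).hom, hφ, hψ, e]

/-! ### Positions and edges -/

theorem length_edges {a b : G} (f : FreeBicategory.Hom a b) : (edges f).length = len f := by
  induction f with
  | of => rfl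
  | id => rfl
  | comp f g hf hg => exact List.length_append.trans (congrArg₂ _ hf hg)

theorem length_edgesT {a b : FreeBicategory G} (f : PseudoTarget.Hom a b) :
    (edgesT f).length = lenT f := by
  induction f with
  | app w => exact length_edges w
  | id => rfl
  | comp f g hf hg => exact List.length_append.trans (congrArg₂ _ hf hg)

theorem FormalShadow.length_edges (x : FormalShadow G) : x.edges.length = x.len := by
  cases x with
  | app x => exact ShadowCoherence.length_edges x.word
  | sh f => exact length_edgesT f

theorem hom₂_edges_eq {a b : FreeBicategory G} {f g : a ⟶ b}
    (η : FreeBicategory.Hom₂ f g) : edges f = edges g := by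
  induction η with
  | id => rfl
  | vcomp _ _ h₁ h₂ => exact h₁.trans h₂
  | whisker_left f _ h => exact congrArg (edges f ++ ·) h
  | whisker_right k _ h => exact congrArg (· ++ edges k) h
  | associator => exact List.append_assoc _ _ _
  | associator_inv => exact (List.append_assoc _ _ _).symm
  | right_unitor => exact List.append_nil _
  | right_unitor_inv => exact (List.append_nil _).symm
  | left_unitor => rfl
  | left_unitor_inv => rfl

theorem edges_eq {a b : FreeBicategory G} {f g : a ⟶ b} (η : f ⟶ g) : edges f = edges g := by
  obtain ⟨η⟩ := η
  exact hom₂_edges_eq η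

theorem PseudoTarget.Hom₂.edgesT_eq {a b : FreeBicategory G} {f g : PseudoTarget.Hom a b}
    (η : PseudoTarget.Hom₂ f g) : edgesT f = edgesT g := by
  induction η with
  | id => rfl
  | vcomp _ _ h₁ h₂ => exact h₁.trans h₂
  | whisker_left f _ h => exact congrArg (edgesT f ++ ·) h
  | whisker_right k _ h => exact congrArg (· ++ edgesT k) h
  | associator => exact List.append_assoc _ _ _
  | associator_inv => exact (List.append_assoc _ _ _).symm
  | right_unitor => exact List.append_nil _
  | right_unitor_inv => exact (List.append_nil _).symm
  | left_unitor => rfl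
  | left_unitor_inv => rfl
  | app η => exact edges_eq η
  | unit => rfl
  | unit_inv => rfl
  | mul => rfl
  | mul_inv => rfl

theorem edgesT_eq {a b : PseudoTarget (FreeBicategory G)} {f g : a ⟶ b} (η : f ⟶ g) :
    edgesT f = edgesT g := by
  obtain ⟨η⟩ := η
  exact PseudoTarget.Hom₂.edgesT_eq η

/-- A bijection of positions matches two lists if it sends each term to an equal term. -/
def Matches {A : Type u₁} (l l' : List A) {m n : ℕ} (e : Fin m ≃ Fin n) : Prop :=
  ∀ i, l'[(e i : ℕ)]? = l[(i : ℕ)]?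

theorem Matches.of_eq {A : Type u₁} {l l' : List A} (hl : l = l') {m n : ℕ} (h : m = n) :
    Matches l l' (finCongr h) := by
  subst hl
  exact fun _ => rfl

theorem Matches.trans {A : Type u₁} {l l' l'' : List A} {m n k : ℕ} {e : Fin m ≃ Fin n}
    {e' : Fin n ≃ Fin k} (h : Matches l l' e) (h' : Matches l' l'' e') :
    Matches l l'' (e.trans e') :=
  fun i => (h' (e i)).trans (h i)

theorem Matches.symm {A : Type u₁} {l l' : List A} {m n : ℕ} {e : Fin m ≃ Fin n}
    (h : Matches l l' e) : Matches l' l e.symm := fun i => by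
  rw [← h, Equiv.apply_symm_apply]

theorem matches_blockRotation {A : Type u₁} {l l' : List A} {m n : ℕ} (hl : l.length = m)
    (hl' : l'.length = n) : Matches (l ++ l') (l' ++ l) (blockRotation m n) := by
  intro i
  have hi := i.2
  rw [blockRotation_val]
  split_ifs with h
  · rw [List.getElem?_append_right (by omega), List.getElem?_append_left (by omega)]
    congr 1
    omega
  · rw [List.getElem?_append_left (by omega), List.getElem?_append_right (by omega), hl]

theorem matches_sourcePermTerm {x y : FreeShadow (FreeBicategory G)} (p : FreeShadow.Term x y) :
    Matches (edges x.word) (edges y.word) (sourcePermTerm p) := by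
  induction p with
  | id => exact .of_eq rfl rfl
  | comp _ _ h h' => exact h.trans h'
  | sh η => exact .of_eq (edges_eq η) _
  | rot f g => exact matches_blockRotation (length_edges f) (length_edges g)
  | rot_inv f g => exact (matches_blockRotation (length_edges f) (length_edges g)).symm

theorem matches_sourcePerm {x y : FreeShadow (FreeBicategory G)} (φ : x ⟶ y) :
    Matches (edges x.word) (edges y.word) (sourcePerm φ) := by
  obtain ⟨p⟩ := φ
  exact matches_sourcePermTerm p

theorem matches_permTerm {x y : FormalShadow G} (p : ShadowTarget.Term x y) :
    Matches x.edges y.edges (permTerm p) := by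
  induction p with
  | id => exact .of_eq rfl rfl
  | comp _ _ h h' => exact h.trans h'
  | app φ => exact matches_sourcePerm φ
  | sh η => exact .of_eq (edgesT_eq η) _
  | rot f g => exact matches_blockRotation (length_edgesT f) (length_edgesT g)
  | rot_inv f g => exact (matches_blockRotation (length_edgesT f) (length_edgesT g)).symm
  | s f => exact .of_eq rfl rfl
  | s_inv f => exact .of_eq rfl rfl

theorem matches_perm {x y : FormalShadow G} (φ : x ⟶ y) :
    Matches x.edges y.edges (perm φ) := by
  obtain ⟨p⟩ := φ
  exact matches_permTerm p

/-- Position `i` of `l` sits at position `i + k` modulo `n` of `l'`, so it is the target list that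
must be rotated to recover the source list. -/
theorem Matches.rotate_eq {A : Type u₁} {l l' : List A} {m n k : ℕ} {e : Fin m ≃ Fin n}
    (h : Matches l l' e) (hl : l.length = m) (hl' : l'.length = n)
    (hk : ∀ i, (e i : ℕ) = (i + k) % n) : l'.rotate k = l := by
  have hmn : m = n := Fin.equiv_iff_eq.mp ⟨e⟩
  refine List.ext_getElem (by simp [hl, hl', hmn]) fun i h₁ h₂ => ?_
  have t := h ⟨i, hl ▸ h₂⟩
  rw [hk] at t
  rw [List.getElem_rotate, ← Option.some_inj, ← List.getElem?_eq_getElem,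
    ← List.getElem?_eq_getElem]
  simpa only [hl'] using t

/-- Cancelling the smaller of the two rotations leaves a rotation by the difference that fixes the
list. -/
theorem Aperiodic.mod_eq_mod {A : Type u₁} {l : List A} (h : Aperiodic l) (h0 : 0 < l.length) {j k : ℕ}
    (e : l.rotate j = l.rotate k) : j % l.length = k % l.length := by
  rw [← List.rotate_mod l j, ← List.rotate_mod l k] at e
  have hj := Nat.mod_lt j h0
  have hk := Nat.mod_lt k h0
  generalize j % l.length = j at *
  generalize k % l.length = k at *
  wlog hjk : j < k generalizing j k
  · rcases (not_lt.mp hjk).lt_or_eq with hlt | heq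
    · exact (this k hk j hj e.symm hlt).symm
    · exact heq.symm
  refine absurd ?_ (h (k - j) (by omega) (by omega))
  apply List.rotate_injective j
  change (l.rotate (k - j)).rotate j = l.rotate j
  rw [List.rotate_rotate, e]
  congr 1
  omega

/-- Both rotations carry the target list back to the same source list, so aperiodicity of the target
makes their amounts congruent. -/
theorem perm_eq_of_aperiodic {x y : FormalShadow G} (h : Aperiodic y.edges) (φ ψ : x ⟶ y) :
    perm φ = perm ψ := by
  obtain ⟨j, hj⟩ := isRotation_perm φ
  obtain ⟨k, hk⟩ := isRotation_perm ψ
  have e := (matches_perm φ).rotate_eq x.length_edges y.length_edges hj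
  have e' := (matches_perm ψ).rotate_eq x.length_edges y.length_edges hk
  refine Equiv.ext fun i => Fin.ext ?_
  -- The empty list is no exception: with no positions there is nothing to compare.
  have hn : 0 < y.edges.length := y.length_edges ▸ (perm φ i).pos
  have t := h.mod_eq_mod hn (e.trans e'.symm)
  rw [y.length_edges] at t
  rw [hj, hk, Nat.add_mod, t, ← Nat.add_mod]

end

/-! ### Commutativity of diagrams -/

section

variable {C : Type u₁} [Bicategory.{w₁, v₁} C] {T : Type u₂} [Category.{v₂} T]
  {D : Type u₃} [Bicategory.{w₃, v₃} D] {T' : Type u₄} [Category.{v₄} T']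
  {S : Shadow C T} {S' : Shadow D T'} {J : Type u} [Quiver.{v} J]

theorem pathComposite_comp {A : Type u₂} [Category.{v₂} A] (F : A ⥤ T') (L : J ⥤q A) {i j : J}
    (p : Quiver.Path i j) :
    pathComposite (L ⋙q F.toPrefunctor) p = F.map (pathComposite L p) := by
  induction p with
  | nil => exact (F.map_id _).symm
  | cons p e ih => exact (congrArg (· ≫ F.map (L.map e)) ih).trans (F.map_comp _ _).symm

theorem diagramCommutes_of_expectedToCommute {Φ : StrongShadowFunctor S S'} {X : J ⥤q T'}
    {L : J ⥤q FormalShadow C} (h : IsFormalLift Φ X L) (hL : ExpectedToCommute L) :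
    DiagramCommutes X := by
  unfold IsFormalLift at h
  subst h
  intro i j p q
  rw [pathComposite_comp, pathComposite_comp, eq_of_perm_eq (hL p q)]

end

end ShadowCoherence

open ShadowCoherence in
theorem mainTheorem8 {C : Type u₁} [Bicategory.{w₁, v₁} C] {T : Type u₂} [Category.{v₂} T]
    {D : Type u₃} [Bicategory.{w₃, v₃} D] {T' : Type u₄} [Category.{v₄} T']
    (S : Shadow C T) (S' : Shadow D T') (Φ : StrongShadowFunctor S S') :
    (∀ {J : Type u} [Quiver.{v} J] (X : J ⥤q T') (L : J ⥤q FormalShadow C),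
      IsFormalLift Φ X L → ExpectedToCommute L → DiagramCommutes X) ∧
    (∀ {x y : FormalShadow C} (φ ψ : x ⟶ y), perm φ = perm ψ → Φ.eval.map φ = Φ.eval.map ψ) ∧
    (∀ {J : Type u} [Quiver.{v} J] (X : J ⥤q T') (L : J ⥤q FormalShadow C),
      IsFormalLift Φ X L → (∀ j, Aperiodic (L.obj j).edges) → DiagramCommutes X) :=
  ⟨fun _ _ h hL => diagramCommutes_of_expectedToCommute h hL,
    fun _ _ h => congrArg Φ.eval.map (eq_of_perm_eq h),
    -- Aperiodicity at the common endpoint `j` of the two paths forces their rotations to agree.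
    fun _ _ h hL => diagramCommutes_of_expectedToCommute h fun _ j _ _ =>
      perm_eq_of_aperiodic (hL j) _ _⟩
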